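/- **Setting.** Let $\mathcal F=\bigoplus_{n\ge 0}L^2(\mathbb R_+^n)$ (complex-valued functions, $L^2(\mathbb R_+^n)=L^2(\mathbb R_+)^{\otimes n}$, $L^2(\mathbb R_+^0)=\mathbb C\Omega$) be the full Fock space over $L^2(\mathbb R_+)$, with vacuum vector $\Omega$. For $h\in L^2(\mathbb R_+)$ let $l(h)$ be the left creation operator, $l(h)(g_1\otimes\cdots\otimes g_n)=h\otimes g_1\otimes\cdots\otimes g_n$, and for real $h\in L^2_{\mathbb R}(\mathbb R_+)$ let $S(h)=l(h)+l(h)^*$. Let $\mathcal{SC}_{alg}$ be the unital $*$-algebra generated by the $S(h)$, $h\in L^2_{\mathbb R}(\mathbb R_+)$, let $\mathcal{SC}=\{S(h)\}''$ be the von Neumann algebra they generate, with the vacuum state $\tau(X)=\langle X\Omega,\Omega\rangle$, and let $L^2(\mathcal{SC})=L^2(\mathcal{SC},\tau)$. Put $S_t=S(\mathbf 1_{[0,t]})$ (the free Brownian motion). *Derivatives.* $\nabla:\mathcal{SC}_{alg}\to L^2(\mathbb R_+)\odot\mathcal{SC}_{alg}\odot\mathcal{SC}_{alg}$ (algebraic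 tensor products) is the unique linear map with $\nabla S(h)=h\cdot 1\otimes 1$ for all $h\in L^2_{\mathbb R}(\mathbb R_+)$ and $\nabla(AB)=A\cdot\nabla B+\nabla A\cdot B$, where $A\cdot(x\otimes y)\cdot B=Ax\otimes yB$. For $p\ge 1$, $$\nabla^p_{t_1,\dots,t_p}=(\mathrm{id}^{\otimes (p-1)}\otimes\nabla_{t_p})\circ\cdots\circ(\mathrm{id}\otimes\nabla_{t_2})\circ\nabla_{t_1},$$ which takes $\mathcal{SC}_{alg}$ into $L^2(\mathbb R_+^p)\odot\mathcal{SC}_{alg}^{\odot(p+1)}$. It is regarded as an unbounded operator from $L^2(\mathcal{SC})$, with dense domain $\mathcal{SC}_{alg}$, to $L^2\big(\mathbb R_+^p,\,L^2(\mathcal{SC}^{\otimes(p+1)},\tau^{\otimes(p+1)})\big)$. *Free Skorohod integral of order $p$.* $\delta^p=(\nabla^p)^*$ is the adjoint of this operator, with domain $\mathrm{dom}(\delta^p)$: a multiprocess $u$ lies in $\mathrm{dom}(\delta^p)$ if $F\mapsto\langle \nabla^pF,u\rangle$ is bounded on $\mathcal{SC}_{alg}$ for the norm of $L^2(\mathcal{SC})$,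 and then $\langle\nabla^pF,u\rangle=\langle F,\delta^p(u)\rangle$ for all $F\in\mathcal{SC}_{alg}$. *Multiple Wigner integral.* $I_p:L^2(\mathbb R_+^p)\to L^2(\mathcal{SC})$ is the unique continuous linear map with $$I_p\big(\mathbf 1_{[u_1,v_1]\times\cdots\times[u_p,v_p]}\big)=(S_{v_1}-S_{u_1})\cdots(S_{v_p}-S_{u_p})$$ for all $0\le u_i\le v_i$ such that the rectangle $[u_1,v_1]\times\cdots\times[u_p,v_p]$ does not meet any diagonal $\{t:t_i=t_j\}$, $i\ne j$. **Proposition.** For every integer $p\ge 1$ and every $f\in L^2(\mathbb R_+^p)$, the deterministic multiprocess $f\cdot 1^{\otimes(p+1)}$, that is $t\mapsto f(t)\,1\otimes\cdots\otimes 1$, belongs to $\mathrm{dom}(\delta^p)$, and $$\delta^p\big(f\cdot 1^{\otimes(p+1)}\big)=I_p(f).$$ -/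

import Mathlib

open MeasureTheory
open scoped TensorProduct

noncomputable section

namespace FreeWigner

/-- Lebesgue measure on `ℝ₊ = [0, ∞)`. -/
abbrev halfLine : Measure ℝ := volume.restrict (Set.Ici 0)

/-- Lebesgue measure on `ℝ₊ⁿ`. -/
abbrev orthant (n : ℕ) : Measure (Fin n → ℝ) := Measure.pi fun _ => halfLine

/-- The complex Hilbert space `L²(ℝ₊)`. -/
abbrev H : Type := Lp ℂ 2 halfLine

/-- The real Hilbert space `L²_ℝ(ℝ₊)`. -/
abbrev HR : Type := Lp ℝ 2 halfLine

/-- The complex Hilbert space `L²(ℝ₊ⁿ) = L²(ℝ₊)^{⊗ n}`. -/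
abbrev L2 (n : ℕ) : Type := Lp ℂ 2 (orthant n)

/-- The inclusion of `L²_ℝ(ℝ₊)` in its complexification `L²(ℝ₊)`. -/
def ofReal : HR →L[ℝ] H := Complex.ofRealCLM.compLpL 2 halfLine

lemma removeNth_qmp {n : ℕ} (i : Fin (n + 1)) :
    Measure.QuasiMeasurePreserving (fun t : Fin (n + 1) → ℝ => i.removeNth t)
      (orthant (n + 1)) (orthant n) :=
  Measure.quasiMeasurePreserving_snd.comp
    (measurePreserving_piFinSuccAbove (fun _ => halfLine) i).quasiMeasurePreserving

lemma eval_qmp {n : ℕ} (i : Fin (n + 1)) :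
    Measure.QuasiMeasurePreserving (fun t : Fin (n + 1) → ℝ => t i) (orthant (n + 1)) halfLine :=
  Measure.quasiMeasurePreserving_fst.comp
    (measurePreserving_piFinSuccAbove (fun _ => halfLine) i).quasiMeasurePreserving

lemma memLp_insertVar {n : ℕ} (i : Fin (n + 1)) (h : H) (f : L2 n) :
    MemLp (fun t => h (t i) * f (i.removeNth t)) 2 (orthant (n + 1)) := by
  have key : MemLp (fun z : ℝ × (Fin n → ℝ) => h z.1 * f z.2) 2
      (halfLine.prod (orthant n)) := by
    rw [memLp_two_iff_integrable_sq_norm]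
    · have h1 := (memLp_two_iff_integrable_sq_norm (Lp.aestronglyMeasurable h)).1 (Lp.memLp h)
      have h2 := (memLp_two_iff_integrable_sq_norm (Lp.aestronglyMeasurable f)).1 (Lp.memLp f)
      simpa [mul_pow] using h1.mul_prod h2
    · exact (Lp.aestronglyMeasurable h).comp_fst.mul (Lp.aestronglyMeasurable f).comp_snd
  exact key.comp_measurePreserving (measurePreserving_piFinSuccAbove (fun _ => halfLine) i)

/-- The tensor `h ⊗ f` in which `h` takes the `i`-th variable:
`t ↦ h(tᵢ) f(t₀, …, tᵢ₋₁, tᵢ₊₁, …, tₙ)`. -/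
def insertVar {n : ℕ} (i : Fin (n + 1)) : H →ₗ[ℂ] L2 n →ₗ[ℂ] L2 (n + 1) :=
  LinearMap.mk₂ ℂ (fun h f => (memLp_insertVar i h f).toLp _)
    (fun h h' f => by
      rw [← MemLp.toLp_add (memLp_insertVar i h f) (memLp_insertVar i h' f)]
      refine (MemLp.toLp_eq_toLp_iff _ _).2 ?_
      filter_upwards [(eval_qmp i).ae (Lp.coeFn_add h h')] with t ht
      simp only [Pi.add_apply] at ht ⊢
      rw [ht]; ring)
    (fun c h f => by
      rw [← MemLp.toLp_const_smul c (memLp_insertVar i h f)]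
      refine (MemLp.toLp_eq_toLp_iff _ _).2 ?_
      filter_upwards [(eval_qmp i).ae (Lp.coeFn_smul c h)] with t ht
      simp only [Pi.smul_apply, smul_eq_mul] at ht ⊢
      rw [ht]; ring)
    (fun h f f' => by
      rw [← MemLp.toLp_add (memLp_insertVar i h f) (memLp_insertVar i h f')]
      refine (MemLp.toLp_eq_toLp_iff _ _).2 ?_
      filter_upwards [(removeNth_qmp i).ae (Lp.coeFn_add f f')] with t ht
      simp only [Pi.add_apply] at ht ⊢
      rw [ht]; ring)
    (fun c h f => by
      rw [← MemLp.toLp_const_smul c (memLp_insertVar i h f)]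
      refine (MemLp.toLp_eq_toLp_iff _ _).2 ?_
      filter_upwards [(removeNth_qmp i).ae (Lp.coeFn_smul c f)] with t ht
      simp only [Pi.smul_apply, smul_eq_mul] at ht ⊢
      rw [ht]; ring)

lemma insertVar_coeFn {n : ℕ} (i : Fin (n + 1)) (h : H) (f : L2 n) :
    insertVar i h f =ᵐ[orthant (n + 1)] fun t => h (t i) * f (i.removeNth t) :=
  MemLp.coeFn_toLp (memLp_insertVar i h f)

lemma inner_insertVar {n : ℕ} (i : Fin (n + 1)) (h k : H) (f g : L2 n) :
    inner ℂ (insertVar i h f) (insertVar i k g) = inner ℂ h k * inner ℂ f g := by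
  rw [L2.inner_def, L2.inner_def, L2.inner_def, ← integral_prod_mul,
    ← (measurePreserving_piFinSuccAbove (fun _ => halfLine) i).integral_comp']
  refine integral_congr_ae ?_
  filter_upwards [insertVar_coeFn i h f, insertVar_coeFn i k g] with t h1 h2
  rw [h1, h2]
  simp only [RCLike.inner_apply, map_mul, MeasurableEquiv.piFinSuccAbove_apply,
    Fin.insertNthEquiv_symm_apply]
  ring

lemma norm_insertVar {n : ℕ} (i : Fin (n + 1)) (h : H) (f : L2 n) :
    ‖insertVar i h f‖ = ‖h‖ * ‖f‖ := by
  have := inner_insertVar i h h f f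
  rw [inner_self_eq_norm_sq_to_K, inner_self_eq_norm_sq_to_K, inner_self_eq_norm_sq_to_K] at this
  norm_cast at this
  rw [← mul_pow] at this
  exact (pow_left_inj₀ (norm_nonneg _) (by positivity) two_ne_zero).1 this

/-- The full Fock space `⨁ₙ L²(ℝ₊ⁿ)` over `L²(ℝ₊)`. -/
abbrev Fock : Type := lp (fun n => L2 n) 2

/-- Inclusion of the tensors of length `n` in the Fock space. -/
def level (n : ℕ) : L2 n →L[ℂ] Fock :=
  LinearMap.mkContinuous (lp.lsingle 2 n) 1 fun f => by
    rw [one_mul]; exact (lp.norm_single (by norm_num) n f).le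

/-- The function `1` of zero variables. -/
def oneL2 : L2 0 := (memLp_const (1 : ℂ) : MemLp (fun _ => (1 : ℂ)) 2 (orthant 0)).toLp

/-- The vacuum vector. -/
def vacuum : Fock := level 0 oneL2

/-- The sequence of components of `l(h) x`. -/
def creationFun (h : H) (x : Fock) : (n : ℕ) → L2 n
  | 0 => 0
  | n + 1 => insertVar 0 h (x n)

lemma creation_summable (h : H) (x : Fock) :
    HasSum (fun n => ‖creationFun h x n‖ ^ 2) (‖h‖ ^ 2 * ‖x‖ ^ 2) := by
  have h1 : HasSum (fun n => ‖x n‖ ^ 2) (‖x‖ ^ 2) := by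
    have := lp.hasSum_norm (p := 2) (by norm_num) x
    simpa using this
  have h2 := h1.mul_left (‖h‖ ^ 2)
  rw [← hasSum_nat_add_iff' 1]
  simpa [creationFun, norm_insertVar, mul_pow] using h2

lemma creation_memLp (h : H) (x : Fock) : Memℓp (creationFun h x) 2 := by
  apply memℓp_gen
  simpa using (creation_summable h x).summable

/-- The left creation operator `l(h)`, `l(h)(g₁ ⊗ … ⊗ gₙ) = h ⊗ g₁ ⊗ … ⊗ gₙ`. -/
def creation (h : H) : Fock →L[ℂ] Fock :=
  LinearMap.mkContinuous
    { toFun := fun x => ⟨creationFun h x, creation_memLp h x⟩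
      map_add' := fun x y => by
        ext1; funext n
        cases n with
        | zero => exact (add_zero 0).symm
        | succ n => exact map_add (insertVar 0 h) (x n) (y n)
      map_smul' := fun c x => by
        ext1; funext n
        cases n <;> simp [creationFun] }
    ‖h‖ fun x => by
      refine le_of_sq_le_sq ?_ (by positivity)
      rw [mul_pow]
      have h1 := lp.hasSum_norm (p := 2) (by norm_num)
        (⟨creationFun h x, creation_memLp h x⟩ : Fock)
      have h2 : HasSum (fun n => ‖creationFun h x n‖ ^ 2)
        (‖(⟨creationFun h x, creation_memLp h x⟩ : Fock)‖ ^ 2) := by simpa using h1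
      exact (h2.unique (creation_summable h x)).le

@[simp] lemma creation_zero (h : H) (x : Fock) : creation h x 0 = 0 := rfl

@[simp] lemma creation_succ (h : H) (x : Fock) (n : ℕ) :
    creation h x (n + 1) = insertVar 0 h (x n) := rfl

/-- The left annihilation operator `l*(h)`. -/
abbrev annihilation (h : H) : Fock →L[ℂ] Fock := ContinuousLinearMap.adjoint (creation h)

/-- The semicircular operator `S(h) = l(h) + l*(h)` of a real `h`. -/
def S (h : HR) : Fock →L[ℂ] Fock := creation (ofReal h) + annihilation (ofReal h)

/-- The algebraic `n`-th tensor power of `E` (a copy without Mathlib's injective seminorm). -/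
def PreTensorPower (E : Type) [NormedAddCommGroup E] [InnerProductSpace ℂ E] (n : ℕ) : Type :=
  ⨂[ℂ]^n E

section TensorPower

variable (E : Type) [NormedAddCommGroup E] [InnerProductSpace ℂ E] (n : ℕ)

instance : AddCommGroup (PreTensorPower E n) := inferInstanceAs (AddCommGroup (⨂[ℂ]^n E))

instance : Module ℂ (PreTensorPower E n) := inferInstanceAs (Module ℂ (⨂[ℂ]^n E))

/-- The linear functional `⊗ xᵢ ↦ ∏ ⟪yᵢ, xᵢ⟫`. -/
def innerLeft (y : Fin n → E) : ⨂[ℂ]^n E →ₗ[ℂ] ℂ :=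
  PiTensorProduct.lift
    ((MultilinearMap.mkPiAlgebra ℂ (Fin n) ℂ).compLinearMap fun i => (innerSL ℂ (y i)).toLinearMap)

variable {E n}

lemma innerLeft_tprod (y x : Fin n → E) :
    innerLeft E n y (PiTensorProduct.tprod ℂ x) = ∏ i, inner ℂ (y i) (x i) := by
  simp [innerLeft]

lemma innerLeft_update_add [DecidableEq (Fin n)] (y : Fin n → E) (i : Fin n) (a b : E) :
    innerLeft E n (Function.update y i (a + b)) =
      innerLeft E n (Function.update y i a) + innerLeft E n (Function.update y i b) := by
  ext x
  simp only [LinearMap.compMultilinearMap_apply, LinearMap.add_apply, innerLeft_tprod]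
  rw [← Finset.mul_prod_erase _ _ (Finset.mem_univ i), ← Finset.mul_prod_erase _ _ (Finset.mem_univ i),
    ← Finset.mul_prod_erase _ _ (Finset.mem_univ i)]
  have h : ∀ c : E, ∏ j ∈ Finset.univ.erase i, inner ℂ (Function.update y i c j) (x j) =
      ∏ j ∈ Finset.univ.erase i, inner ℂ (y j) (x j) := fun c =>
    Finset.prod_congr rfl fun j hj => by rw [Function.update_of_ne (Finset.ne_of_mem_erase hj)]
  simp only [h, Function.update_self, inner_add_left, add_mul]

lemma innerLeft_update_smul [DecidableEq (Fin n)] (y : Fin n → E) (i : Fin n) (c : ℂ) (a : E) :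
    innerLeft E n (Function.update y i (c • a)) =
      (starRingEnd ℂ c) • innerLeft E n (Function.update y i a) := by
  ext x
  simp only [LinearMap.compMultilinearMap_apply, LinearMap.smul_apply, innerLeft_tprod]
  rw [← Finset.mul_prod_erase _ _ (Finset.mem_univ i), ← Finset.mul_prod_erase _ _ (Finset.mem_univ i)]
  have h : ∀ c : E, ∏ j ∈ Finset.univ.erase i, inner ℂ (Function.update y i c j) (x j) =
      ∏ j ∈ Finset.univ.erase i, inner ℂ (y j) (x j) := fun c =>
    Finset.prod_congr rfl fun j hj => by rw [Function.update_of_ne (Finset.ne_of_mem_erase hj)]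
  simp only [h, Function.update_self, inner_smul_left, smul_eq_mul, mul_assoc]

/-- Conjugate of a linear functional. -/
def conjFunctional (V : Type) [AddCommGroup V] [Module ℂ V] (φ : V →ₗ[ℂ] ℂ) :
    V →ₛₗ[starRingEnd ℂ] ℂ where
  toFun x := starRingEnd ℂ (φ x)
  map_add' x y := by simp
  map_smul' c x := by simp

/-- The form `(y, x) ↦ ⟪x, y⟫` on the algebraic tensor power, linear in `y` and conjugate-linear
in `x`, with `⟪⊗ xᵢ, ⊗ yᵢ⟫ = ∏ ⟪xᵢ, yᵢ⟫`. -/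
def tensorForm (E : Type) [NormedAddCommGroup E] [InnerProductSpace ℂ E] (n : ℕ) :
    ⨂[ℂ]^n E →ₗ[ℂ] ⨂[ℂ]^n E →ₛₗ[starRingEnd ℂ] ℂ :=
  PiTensorProduct.lift
    { toFun := fun y => conjFunctional _ (innerLeft E n y)
      map_update_add' := fun y i a b => by
        ext x; simp [conjFunctional, innerLeft_update_add]
      map_update_smul' := fun y i c a => by
        ext x; simp [conjFunctional, innerLeft_update_smul] }

lemma tensorForm_tprod (y x : Fin n → E) :
    tensorForm E n (PiTensorProduct.tprod ℂ y) (PiTensorProduct.tprod ℂ x) =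
      ∏ i, inner ℂ (x i) (y i) := by
  simp [tensorForm, conjFunctional, innerLeft_tprod]

lemma tensorForm_symm (y x : ⨂[ℂ]^n E) :
    starRingEnd ℂ (tensorForm E n y x) = tensorForm E n x y := by
  induction y using PiTensorProduct.induction_on with
  | smul_tprod r y =>
    induction x using PiTensorProduct.induction_on with
    | smul_tprod s x =>
      simp only [map_smul, LinearMap.map_smulₛₗ, LinearMap.smul_apply, tensorForm_tprod,
        smul_eq_mul, map_mul, map_prod, inner_conj_symm, RCLike.conj_conj]
      ring
    | add a b ha hb => simp only [map_add, LinearMap.add_apply, ha, hb]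
  | add a b ha hb => simp only [map_add, LinearMap.add_apply, ha, hb]

open scoped ComplexOrder in
lemma posSemidef_prod_gram {m : ℕ} (v : Fin n → Fin m → E) :
    (Matrix.of fun j k => ∏ i, inner ℂ (v i j) (v i k) : Matrix (Fin m) (Fin m) ℂ).PosSemidef := by
  induction n with
  | zero =>
    have : (Matrix.of fun j k => ∏ i : Fin 0, inner ℂ (v i j) (v i k) : Matrix (Fin m) (Fin m) ℂ) =
      Matrix.gram ℂ (fun _ : Fin m => (1 : ℂ)) := by ext j k; simp [Matrix.gram]
    rw [this]; exact Matrix.posSemidef_gram _ _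
  | succ n ih =>
    have := (Matrix.posSemidef_gram ℂ (v 0)).hadamard (ih fun i => v i.succ)
    have e : (Matrix.of fun j k => ∏ i, inner ℂ (v i j) (v i k) : Matrix (Fin m) (Fin m) ℂ) =
        Matrix.hadamard (Matrix.gram ℂ (v 0))
          (Matrix.of fun j k => ∏ i : Fin n, inner ℂ (v i.succ j) (v i.succ k)) := by
      ext j k
      simp [Matrix.gram, Fin.prod_univ_succ]
    rw [e]
    exact this

lemma exists_sum_tprod (x : ⨂[ℂ]^n E) : ∃ (m : ℕ) (c : Fin m → ℂ) (v : Fin m → Fin n → E),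
    x = ∑ j, c j • PiTensorProduct.tprod ℂ (v j) := by
  induction x using PiTensorProduct.induction_on with
  | smul_tprod r y => exact ⟨1, fun _ => r, fun _ => y, by simp⟩
  | add a b ha hb =>
    obtain ⟨m, c, v, rfl⟩ := ha
    obtain ⟨m', c', v', rfl⟩ := hb
    exact ⟨m + m', Fin.append c c', Fin.append v v', by simp [Fin.sum_univ_add]⟩

open scoped ComplexOrder in
lemma tensorForm_nonneg (x : ⨂[ℂ]^n E) : 0 ≤ (tensorForm E n x x).re := by
  obtain ⟨m, c, v, rfl⟩ := exists_sum_tprod x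
  have h := (posSemidef_prod_gram fun i j => v j i).dotProduct_mulVec_nonneg c
  have e : tensorForm E n (∑ j, c j • PiTensorProduct.tprod ℂ (v j))
      (∑ j, c j • PiTensorProduct.tprod ℂ (v j)) =
      dotProduct (star c) (Matrix.mulVec
        (Matrix.of fun j k => ∏ i, inner ℂ (v j i) (v k i) : Matrix (Fin m) (Fin m) ℂ) c) := by
    simp only [map_sum, map_smul, LinearMap.sum_apply, LinearMap.smul_apply,
      LinearMap.map_smulₛₗ, tensorForm_tprod, dotProduct, Matrix.mulVec, Finset.mul_sum,
      smul_eq_mul, Matrix.of_apply, Pi.star_apply]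
    refine Finset.sum_congr rfl fun j _ => Finset.sum_congr rfl fun k _ => ?_
    simp only [starRingEnd_apply]
    ring
  rw [e]
  exact (Complex.le_def.1 h).1

/-- The inner product `⟪⊗ xᵢ, ⊗ yᵢ⟫ = ∏ ⟪xᵢ, yᵢ⟫` on the algebraic tensor power. -/
@[reducible] def tensorCore (E : Type) [NormedAddCommGroup E] [InnerProductSpace ℂ E] (n : ℕ) :
    PreInnerProductSpace.Core ℂ (PreTensorPower E n) where
  inner x y := tensorForm E n y x
  conj_inner_symm x y := tensorForm_symm x y
  re_inner_nonneg x := tensorForm_nonneg x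
  add_left x y z := (tensorForm E n z).map_add x y
  smul_left x y c := (tensorForm E n y).map_smulₛₗ c x

instance : SeminormedAddCommGroup (PreTensorPower E n) :=
  @InnerProductSpace.Core.toSeminormedAddCommGroup ℂ _ _ _ _ (tensorCore E n)

instance : InnerProductSpace ℂ (PreTensorPower E n) := InnerProductSpace.ofCore (tensorCore E n)

/-- The Hilbert space tensor power `E^{⊗ n}`. -/
abbrev HilbertTensorPower (E : Type) [NormedAddCommGroup E] [InnerProductSpace ℂ E] (n : ℕ) :
    Type := UniformSpace.Completion (PreTensorPower E n)

/-- The algebraic tensor power inside the Hilbert space tensor power. -/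
def ofTensor (E : Type) [NormedAddCommGroup E] [InnerProductSpace ℂ E] (n : ℕ) :
    ⨂[ℂ]^n E →ₗ[ℂ] HilbertTensorPower E n :=
  (UniformSpace.Completion.toComplₗᵢ (𝕜 := ℂ) (E := PreTensorPower E n)).toLinearMap

lemma inner_ofTensor_tprod (x y : Fin n → E) :
    inner ℂ (ofTensor E n (PiTensorProduct.tprod ℂ x)) (ofTensor E n (PiTensorProduct.tprod ℂ y)) =
      ∏ i, inner ℂ (x i) (y i) :=
  (UniformSpace.Completion.inner_coe _ _).trans (tensorForm_tprod y x)

end TensorPower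

lemma star_S (h : HR) : star (S h) = S h := by
  simp [S, ContinuousLinearMap.star_eq_adjoint, add_comm]

lemma inner_creation (h k : H) (x y : Fock) :
    inner ℂ (creation h x) (creation k y) = inner ℂ h k * inner ℂ x y := by
  have h1 := lp.hasSum_inner (𝕜 := ℂ) (creation h x) (creation k y)
  have h2 : HasSum (fun n => inner ℂ (creation h x (n + 1)) (creation k y (n + 1)))
      (inner ℂ h k * inner ℂ x y) := by
    have h3 := (lp.hasSum_inner (𝕜 := ℂ) x y).mul_left (inner ℂ h k)
    refine h3.congr_fun ?_
    intro n
    exact inner_insertVar 0 h k (x n) (y n)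
  have h4 := (hasSum_nat_add_iff (f := fun n => inner ℂ (creation h x n) (creation k y n)) 1).1 h2
  rw [Finset.sum_range_one, creation_zero, inner_zero_left, add_zero] at h4
  exact h1.unique h4

lemma annihilation_creation (h k : H) (x : Fock) :
    annihilation h (creation k x) = inner ℂ h k • x := by
  refine ext_inner_left ℂ fun y => ?_
  rw [ContinuousLinearMap.adjoint_inner_right, inner_creation, inner_smul_right]

lemma level_apply_self (n : ℕ) (f : L2 n) : level n f n = f := lp.single_apply_self 2 n f

lemma level_apply_ne {n m : ℕ} (hmn : m ≠ n) (f : L2 n) : level n f m = 0 :=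
  lp.single_apply_ne 2 n f hmn

lemma inner_level (n : ℕ) (f : L2 n) (x : Fock) : inner ℂ (level n f) x = inner ℂ f (x n) :=
  lp.inner_single_left n f x

lemma creation_level (h : H) (n : ℕ) (f : L2 n) :
    creation h (level n f) = level (n + 1) (insertVar 0 h f) := by
  ext1; funext m
  cases m with
  | zero => rw [creation_zero, level_apply_ne (by omega)]
  | succ m =>
    rw [creation_succ]
    by_cases hm : m = n
    · subst hm; rw [level_apply_self, level_apply_self]
    · rw [level_apply_ne hm, level_apply_ne (by omega), map_zero]

lemma annihilation_apply_eq_zero (h : H) (x : Fock) (n : ℕ) (hx : x (n + 1) = 0) :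
    annihilation h x n = 0 := by
  rw [← inner_self_eq_zero (𝕜 := ℂ), ← inner_level, ContinuousLinearMap.adjoint_inner_right,
    creation_level, inner_level, hx, inner_zero_right]

lemma ofReal_coeFn (h : HR) : ofReal h =ᵐ[halfLine] fun t => (h t : ℂ) :=
  ContinuousLinearMap.coeFn_compLpL _ _

lemma inner_ofReal (h k : HR) : inner ℂ (ofReal h) (ofReal k) = ((inner ℝ h k : ℝ) : ℂ) := by
  rw [L2.inner_def, L2.inner_def, ← integral_complex_ofReal]
  refine integral_congr_ae ?_
  filter_upwards [ofReal_coeFn h, ofReal_coeFn k] with t h1 h2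
  rw [h1, h2]
  simp [RCLike.inner_apply]

lemma ofReal_smul (r : ℝ) (h : HR) : ofReal (r • h) = (r : ℂ) • ofReal h := by
  rw [map_smul]
  refine Lp.ext ?_
  filter_upwards [Lp.coeFn_smul r (ofReal h), Lp.coeFn_smul (r : ℂ) (ofReal h)] with t h1 h2
  rw [h1, h2]; simp

lemma creation_add (h k : H) : creation (h + k) = creation h + creation k := by
  ext1 x; ext1; funext n
  cases n with
  | zero => exact (add_zero 0).symm
  | succ n => exact congrArg (fun φ : L2 n →ₗ[ℂ] L2 (n + 1) => φ (x n)) (map_add (insertVar 0) h k)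

lemma creation_smul (c : ℂ) (h : H) : creation (c • h) = c • creation h := by
  ext1 x; ext1; funext n
  cases n with
  | zero => exact (smul_zero c).symm
  | succ n => exact congrArg (fun φ : L2 n →ₗ[ℂ] L2 (n + 1) => φ (x n)) (map_smul (insertVar 0) c h)

lemma S_add (h k : HR) : S (h + k) = S h + S k := by
  simp only [S, annihilation, map_add, creation_add]
  abel

lemma S_smul (r : ℝ) (h : HR) : S (r • h) = (r : ℂ) • S h := by
  rw [S, annihilation, ofReal_smul, creation_smul, map_smulₛₗ, Complex.conj_ofReal, ← smul_add]
  rfl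

/-- The unital `*`-algebra generated by the semicircular operators `S(h)`, `h` real. -/
def SCalg : StarSubalgebra ℂ (Fock →L[ℂ] Fock) := StarAlgebra.adjoin ℂ (Set.range S)

/-- The von Neumann algebra `{S(h) : h ∈ L²_ℝ(ℝ₊)}''`. -/
def SC : VonNeumannAlgebra Fock where
  toStarSubalgebra := StarSubalgebra.centralizer ℂ
    (StarSubalgebra.centralizer ℂ (Set.range S) : Set (Fock →L[ℂ] Fock))
  centralizer_centralizer' := by
    change Set.centralizer (Set.centralizer (SetLike.coe (StarSubalgebra.centralizer ℂ
      (StarSubalgebra.centralizer ℂ (Set.range S) : Set (Fock →L[ℂ] Fock))))) =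
        (SetLike.coe (StarSubalgebra.centralizer ℂ
      (StarSubalgebra.centralizer ℂ (Set.range S) : Set (Fock →L[ℂ] Fock))))
    rw [StarSubalgebra.coe_centralizer_centralizer]
    simp

lemma coe_SC : (SC : Set (Fock →L[ℂ] Fock)) = Set.centralizer (Set.centralizer (Set.range S)) := by
  have h : star (Set.range S) = Set.range S := by
    ext x
    simp only [Set.mem_star, Set.mem_range]
    refine ⟨fun ⟨y, hy⟩ => ⟨y, ?_⟩, fun ⟨y, hy⟩ => ⟨y, ?_⟩⟩
    · rw [← star_star x, ← hy, star_S]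
    · rw [← hy, star_S]
  change SetLike.coe (StarSubalgebra.centralizer ℂ
      (StarSubalgebra.centralizer ℂ (Set.range S) : Set (Fock →L[ℂ] Fock))) = _
  rw [StarSubalgebra.coe_centralizer_centralizer, h, Set.union_self]

lemma SCalg_le_SC : SCalg ≤ SC.toStarSubalgebra :=
  StarAlgebra.adjoin_le_centralizer_centralizer ℂ _

/-- The vacuum state `τ(X) = ⟨XΩ, Ω⟩` (Mathlib's inner product is linear in the second slot). -/
def tau (X : Fock →L[ℂ] Fock) : ℂ := inner ℂ vacuum (X vacuum)

/-- The space `L²(𝒮𝒞, τ)`: the completion of `𝒮𝒞` for `⟨X, Y⟩ = τ(Y* X)`, realised as the closure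
of `𝒮𝒞 Ω` in the Fock space through `X ↦ X Ω`. -/
def L2SCsub : Submodule ℂ Fock :=
  (SC.toStarSubalgebra.toSubalgebra.toSubmodule.map
    (ContinuousLinearMap.apply ℂ Fock vacuum).toLinearMap).topologicalClosure

/-- The Hilbert space `L²(𝒮𝒞, τ)`. -/
abbrev L2SC : Type := L2SCsub

instance : CompleteSpace L2SC := inferInstanceAs (CompleteSpace (Submodule.topologicalClosure _))

/-- The embedding `X ↦ X Ω` of `𝒮𝒞` in `L²(𝒮𝒞, τ)`. -/
def toL2 : SC.toStarSubalgebra →ₗ[ℂ] L2SC :=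
  LinearMap.codRestrict L2SCsub
    ((ContinuousLinearMap.apply ℂ Fock vacuum).toLinearMap ∘ₗ
      SC.toStarSubalgebra.toSubalgebra.toSubmodule.subtype)
    fun X => Submodule.le_topologicalClosure _ (Submodule.mem_map_of_mem X.2)

lemma inner_toL2 (X Y : SC.toStarSubalgebra) :
    inner ℂ (toL2 X) (toL2 Y) = tau (star (X : Fock →L[ℂ] Fock) * Y) :=
  (ContinuousLinearMap.adjoint_inner_right (X : Fock →L[ℂ] Fock) vacuum _).symm

lemma denseRange_toL2 : DenseRange toL2 := by
  refine Subtype.dense_iff.2 fun x hx => closure_mono ?_ hx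
  rintro _ ⟨X, hX, rfl⟩
  exact ⟨toL2 ⟨X, hX⟩, ⟨_, rfl⟩, rfl⟩

/-- The embedding `F ↦ F Ω` of the algebra `𝒮𝒞_alg` in `L²(𝒮𝒞, τ)`. -/
def algToL2 : SCalg →ₗ[ℂ] L2SC :=
  toL2 ∘ₗ Submodule.inclusion
    (p := SCalg.toSubalgebra.toSubmodule) (p' := SC.toStarSubalgebra.toSubalgebra.toSubmodule)
    SCalg_le_SC

lemma algToL2_coe (X : SCalg) : (algToL2 X : Fock) = (X : Fock →L[ℂ] Fock) vacuum := rfl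

/-- `S(h)` as an element of `𝒮𝒞_alg`. -/
def Salg (h : HR) : SCalg := ⟨S h, StarAlgebra.subset_adjoin ℂ _ ⟨h, rfl⟩⟩

/-- `x` has no component of length `≥ n`. -/
def DegLT (n : ℕ) (x : Fock) : Prop := ∀ m, n ≤ m → x m = 0

lemma DegLT.mono {n m : ℕ} (hnm : n ≤ m) {x : Fock} (hx : DegLT n x) : DegLT m x :=
  fun k hk => hx k (hnm.trans hk)

lemma DegLT.eq_zero {x : Fock} (hx : DegLT 0 x) : x = 0 := by
  ext1; funext m; exact hx m (Nat.zero_le m)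

lemma DegLT.annihilation {n : ℕ} {x : Fock} (hx : DegLT (n + 1) x) (h : H) :
    DegLT n (annihilation h x) :=
  fun m hm => annihilation_apply_eq_zero h x m (hx _ (by omega))

lemma DegLT.S {n : ℕ} {x : Fock} (hx : DegLT n x) (h : HR) : DegLT (n + 1) (S h x) := by
  intro m hm
  have h1 : FreeWigner.annihilation (ofReal h) x m = 0 :=
    (hx.mono (by omega : n ≤ n + 1 + 1)).annihilation _ m (by omega)
  obtain ⟨m, rfl⟩ : ∃ k, m = k + 1 := ⟨m - 1, by omega⟩
  have h2 : creation (ofReal h) x (m + 1) = 0 := by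
    rw [creation_succ, hx m (by omega), map_zero]
  change creation (ofReal h) x (m + 1) + FreeWigner.annihilation (ofReal h) x (m + 1) = 0
  rw [h1, h2, add_zero]

/-- A linear basis of `L²_ℝ(ℝ₊)`. -/
def realBasis : Module.Basis (Module.Basis.ofVectorSpaceIndex ℝ HR) ℝ HR :=
  Module.Basis.ofVectorSpace ℝ HR

/-- The index set of `realBasis`. -/
abbrev Letter : Type := Module.Basis.ofVectorSpaceIndex ℝ HR

/-- The product `S(b_{j₁}) ⋯ S(b_{jₙ})`. -/
def word (w : List Letter) : SCalg := (w.map fun j => Salg (realBasis j)).prod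

lemma word_append (u w : List Letter) : word (u ++ w) = word u * word w := by
  induction u with
  | nil => simp [word]
  | cons j u ih => simp [word, mul_assoc]

lemma star_Salg (h : HR) : star (Salg h) = Salg h := Subtype.ext (star_S h)

lemma star_word (w : List Letter) : star (word w) = word w.reverse := by
  induction w with
  | nil => simp [word]
  | cons j w ih =>
    have h : word (j :: w) = Salg (realBasis j) * word w := by simp [word]
    rw [h, star_mul, ih, star_Salg, List.reverse_cons, word_append]
    simp [word]

lemma Salg_add (h k : HR) : Salg (h + k) = Salg h + Salg k := Subtype.ext (S_add h k)

lemma Salg_smul (r : ℝ) (h : HR) : Salg (r • h) = (r : ℂ) • Salg h := Subtype.ext (S_smul r h)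

/-- Induction over `L²_ℝ(ℝ₊)` along the basis. -/
lemma HR_induction {P : HR → Prop} (basis : ∀ j, P (realBasis j)) (zero : P 0)
    (add : ∀ h k, P h → P k → P (h + k)) (smul : ∀ (r : ℝ) h, P h → P (r • h)) (h : HR) : P h := by
  have hh : h ∈ Submodule.span ℝ (Set.range realBasis) := by
    rw [realBasis.span_eq]; trivial
  induction hh using Submodule.span_induction with
  | mem x hx => obtain ⟨j, rfl⟩ := hx; exact basis j
  | zero => exact zero
  | add x y _ _ hx hy => exact add x y hx hy
  | smul r x _ hx => exact smul r x hx

lemma Salg_zero : Salg 0 = 0 := by simpa using Salg_smul 0 0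

lemma Salg_mem_span (h : HR) : Salg h ∈ Submodule.span ℂ (Set.range word) := by
  induction h using HR_induction with
  | basis j => exact Submodule.subset_span ⟨[j], by simp [word]⟩
  | zero => rw [Salg_zero]; exact zero_mem _
  | add h k hh hk => rw [Salg_add]; exact add_mem hh hk
  | smul r h hh => rw [Salg_smul]; exact Submodule.smul_mem _ _ hh

lemma mul_mem_span (a b : SCalg) (ha : a ∈ Submodule.span ℂ (Set.range word))
    (hb : b ∈ Submodule.span ℂ (Set.range word)) :
    a * b ∈ Submodule.span ℂ (Set.range word) := by
  have h := Submodule.mul_mem_mul ha hb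
  rw [Submodule.span_mul_span] at h
  refine Submodule.span_mono ?_ h
  rintro _ ⟨_, ⟨u, rfl⟩, _, ⟨w, rfl⟩, rfl⟩
  exact ⟨u ++ w, word_append u w⟩

lemma span_word : Submodule.span ℂ (Set.range word) = ⊤ := by
  suffices h : ∀ (a : Fock →L[ℂ] Fock) (ha : a ∈ SCalg),
      (⟨a, ha⟩ : SCalg) ∈ Submodule.span ℂ (Set.range word) from
    eq_top_iff.2 fun a _ => h a.1 a.2
  intro a ha
  induction ha using StarAlgebra.adjoin_induction with
  | mem x hx => obtain ⟨h, rfl⟩ := hx; exact Salg_mem_span h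
  | algebraMap c =>
    have : (⟨algebraMap ℂ _ c, algebraMap_mem SCalg c⟩ : SCalg) = c • word [] := by
      simp only [word]; exact Subtype.ext (Algebra.algebraMap_eq_smul_one c)
    rw [this]
    exact Submodule.smul_mem _ _ (Submodule.subset_span ⟨[], rfl⟩)
  | add x y hx hy h1 h2 => exact Submodule.add_mem _ h1 h2
  | mul x y hx hy h1 h2 => exact mul_mem_span _ _ h1 h2
  | star x hx h1 =>
    have key : ∀ a : SCalg, a ∈ Submodule.span ℂ (Set.range word) →
        star a ∈ Submodule.span ℂ (Set.range word) := by
      intro a ha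
      induction ha using Submodule.span_induction with
      | mem x hx => obtain ⟨w, rfl⟩ := hx; exact Submodule.subset_span ⟨w.reverse, (star_word w).symm⟩
      | zero => simp
      | add x y _ _ hx hy => rw [star_add]; exact add_mem hx hy
      | smul c x _ hx => rw [star_smul]; exact Submodule.smul_mem _ _ hx
    have e : (⟨star x, star_mem hx⟩ : SCalg) = star ⟨x, hx⟩ := Subtype.ext rfl
    have h2 := key ⟨x, hx⟩ h1
    rw [← e] at h2
    exact h2

/-- The vector `S(b_{j₁}) ⋯ S(b_{jₙ}) Ω`. -/
def wordVec (w : List Letter) : Fock := (word w : Fock →L[ℂ] Fock) vacuum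

lemma wordVec_cons (j : Letter) (w : List Letter) :
    wordVec (j :: w) = S (realBasis j) (wordVec w) := rfl

lemma wordVec_deg (w : List Letter) : DegLT (w.length + 1) (wordVec w) := by
  induction w with
  | nil => exact fun m hm => level_apply_ne (by simp at hm; omega) _
  | cons j w ih => rw [wordVec_cons]; exact ih.S _

/-- Successive annihilation by the vectors attached to the letters of a word. -/
def annWord (k : Letter → HR) : List Letter → Fock → Fock
  | [], x => x
  | j :: u, x => annWord k u (annihilation (ofReal (k j)) x)

lemma annWord_add (k : Letter → HR) (u : List Letter) (x y : Fock) :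
    annWord k u (x + y) = annWord k u x + annWord k u y := by
  induction u generalizing x y with
  | nil => rfl
  | cons j u ih => simp [annWord, ih]

lemma annWord_smul (k : Letter → HR) (u : List Letter) (c : ℂ) (x : Fock) :
    annWord k u (c • x) = c • annWord k u x := by
  induction u generalizing x with
  | nil => rfl
  | cons j u ih => simp [annWord, ih]

/-- `annWord` as a linear map. -/
def annWordL (k : Letter → HR) (u : List Letter) : Fock →ₗ[ℂ] Fock where
  toFun := annWord k u
  map_add' := annWord_add k u
  map_smul' := annWord_smul k u

lemma annWord_eq_zero (k : Letter → HR) (u : List Letter) (x : Fock) (hx : DegLT u.length x) :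
    annWord k u x = 0 := by
  induction u generalizing x with
  | nil => exact hx.eq_zero
  | cons j u ih => exact ih _ (hx.annihilation _)

/-- The pairing of two words. -/
def pairing (k : Letter → HR) : List Letter → List Letter → ℝ
  | [], [] => 1
  | j :: u, i :: w => inner ℝ (k j) (realBasis i) * pairing k u w
  | _, _ => 0

lemma annWord_wordVec (k : Letter → HR) (u w : List Letter) (h : u.length = w.length) :
    annWord k u (wordVec w) = (pairing k u w : ℂ) • vacuum := by
  induction u generalizing w with
  | nil =>
    obtain rfl : w = [] := by simpa using h.symm
    simp [annWord, pairing, wordVec, word]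
  | cons j u ih =>
    cases w with
    | nil => simp at h
    | cons i w =>
      have hl : u.length = w.length := by simpa using h
      have e : annihilation (ofReal (k j)) (wordVec (i :: w)) =
          ((inner ℝ (k j) (realBasis i) : ℝ) : ℂ) • wordVec w +
            annihilation (ofReal (k j)) (annihilation (ofReal (realBasis i)) (wordVec w)) := by
        rw [wordVec_cons]
        change annihilation (ofReal (k j)) (creation _ (wordVec w) + annihilation _ (wordVec w)) = _
        rw [map_add, annihilation_creation, inner_ofReal]
      have z : annWord k u
          (annihilation (ofReal (k j)) (annihilation (ofReal (realBasis i)) (wordVec w))) = 0 := by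
        refine annWord_eq_zero k u _ (DegLT.annihilation (DegLT.mono (Nat.le_succ _) ?_) _)
        rw [hl]
        exact (wordVec_deg w).annihilation _
      rw [annWord, e, annWord_add, annWord_smul, z, add_zero, ih w hl, smul_smul, pairing]
      push_cast
      rfl

lemma exists_biorthogonal (J : Finset Letter) : ∃ k : Letter → HR, ∀ j,
    inner ℝ (k j) (realBasis j) ≠ 0 ∧ ∀ i ∈ J, i ≠ j → inner ℝ (k j) (realBasis i) = 0 := by
  suffices h : ∀ j, ∃ k : HR, inner ℝ k (realBasis j) ≠ 0 ∧
      ∀ i ∈ J, i ≠ j → inner ℝ k (realBasis i) = 0 by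
    choose k hk using h
    exact ⟨k, hk⟩
  classical
  intro j
  set V : Submodule ℝ HR := Submodule.span ℝ ((J.erase j).image realBasis : Finset HR) with hV
  have : FiniteDimensional ℝ V := FiniteDimensional.span_finset ℝ _
  have hperp : ∀ x ∈ V, inner ℝ (realBasis j - V.starProjection (realBasis j)) x = 0 := fun x hx =>
    Submodule.starProjection_inner_eq_zero _ x hx
  refine ⟨realBasis j - V.starProjection (realBasis j), fun h0 => ?_, fun i hi hij =>
    hperp _ (Submodule.subset_span (by
      simp only [Finset.coe_image, Set.mem_image, Finset.mem_coe, Finset.mem_erase]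
      exact ⟨i, ⟨hij, hi⟩, rfl⟩))⟩
  have hself : inner ℝ (realBasis j - V.starProjection (realBasis j))
      (realBasis j - V.starProjection (realBasis j)) = 0 := by
    rw [inner_sub_right, h0, hperp _ (Submodule.starProjection_apply_mem V _), sub_zero]
  have hj : realBasis j ∈ V := by
    rw [inner_self_eq_zero, sub_eq_zero] at hself
    rw [hself]; exact Submodule.starProjection_apply_mem V _
  have hli := realBasis.linearIndependent
  rw [hV, Finset.coe_image] at hj
  exact hli.notMem_span_image (by simp) hj

lemma pairing_self (k : Letter → HR) (hk : ∀ j, inner ℝ (k j) (realBasis j) ≠ 0)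
    (u : List Letter) : pairing k u u ≠ 0 := by
  induction u with
  | nil => simp [pairing]
  | cons j u ih => exact mul_ne_zero (hk j) ih

lemma pairing_ne (k : Letter → HR) (J : Finset Letter)
    (hk : ∀ j, ∀ i ∈ J, i ≠ j → inner ℝ (k j) (realBasis i) = 0)
    (u w : List Letter) (hw : ∀ i ∈ w, i ∈ J) (h : u ≠ w) : pairing k u w = 0 := by
  induction u generalizing w with
  | nil =>
    cases w with
    | nil => exact absurd rfl h
    | cons i w => rfl
  | cons j u ih =>
    cases w with
    | nil => rfl
    | cons i w =>
      rw [pairing]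
      by_cases hij : i = j
      · subst hij
        rw [ih w (fun a ha => hw a (by simp [ha])) (fun e => h (by rw [e])), mul_zero]
      · rw [hk j i (hw i (by simp)) hij, zero_mul]

lemma vacuum_ne_zero : vacuum ≠ 0 := by
  intro h
  have h1 : inner ℂ vacuum vacuum = (1 : ℂ) := by
    rw [vacuum, inner_level, level_apply_self, L2.inner_def]
    have : (fun a => inner ℂ (oneL2 a) (oneL2 a)) =ᵐ[orthant 0] fun _ => (1 : ℂ) := by
      have h := MemLp.coeFn_toLp (memLp_const (1 : ℂ) : MemLp (fun _ => (1 : ℂ)) 2 (orthant 0))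
      filter_upwards [h] with t ht
      rw [oneL2, ht]; simp
    rw [integral_congr_ae this]; simp [measureReal_def]
  rw [h, inner_zero_left] at h1
  exact zero_ne_one h1

lemma linearIndependent_wordVec : LinearIndependent ℂ wordVec := by
  classical
  rw [linearIndependent_iff']
  intro s g hg
  by_contra hne
  push Not at hne
  obtain ⟨w₀, hw₀, hgw₀⟩ := hne
  obtain ⟨u, hu, hmax⟩ := (s.filter fun w => g w ≠ 0).exists_max_image List.length
    ⟨w₀, by simp [hw₀, hgw₀]⟩
  rw [Finset.mem_filter] at hu
  obtain ⟨k, hk⟩ := exists_biorthogonal (s.biUnion List.toFinset)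
  have h0 : annWordL k u (∑ w ∈ s, g w • wordVec w) = 0 := by rw [hg, map_zero]
  rw [map_sum, Finset.sum_eq_single u] at h0
  · rw [map_smul] at h0
    change g u • annWord k u (wordVec u) = 0 at h0
    rw [annWord_wordVec k u u rfl, smul_smul, smul_eq_zero] at h0
    rcases h0 with h0 | h0
    · rcases mul_eq_zero.1 h0 with h0 | h0
      · exact hu.2 h0
      · exact pairing_self k (fun j => (hk j).1) u (by exact_mod_cast h0)
    · exact vacuum_ne_zero h0
  · intro w hw hwu
    rw [map_smul]
    by_cases hgw : g w = 0
    · rw [hgw, zero_smul]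
    change g w • annWord k u (wordVec w) = 0
    rcases (hmax w (by simp [hw, hgw])).lt_or_eq with hlt | heq
    · rw [annWord_eq_zero k u _ ((wordVec_deg w).mono hlt), smul_zero]
    · rw [annWord_wordVec k u w heq.symm, pairing_ne k _ (fun j => (hk j).2) u w
        (fun i hi => Finset.mem_biUnion.2 ⟨w, hw, by simpa using hi⟩) (Ne.symm hwu)]
      simp
  · intro h; exact absurd hu.1 h

lemma linearIndependent_algToL2 : LinearIndependent ℂ fun w => algToL2 (word w) :=
  LinearIndependent.of_comp L2SCsub.subtype linearIndependent_wordVec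

/-- The products of `S(b_j)` form a linear basis of `𝒮𝒞_alg`. -/
def wordBasis : Module.Basis (List Letter) ℂ SCalg :=
  Module.Basis.mk (LinearIndependent.of_comp algToL2 linearIndependent_algToL2) span_word.ge

lemma wordBasis_apply (w : List Letter) : wordBasis w = word w := by simp [wordBasis]

lemma algToL2_injective : Function.Injective algToL2 := by
  rw [injective_iff_map_eq_zero]
  intro a ha
  have h := linearIndependent_algToL2
  rw [linearIndependent_iff] at h
  have h2 : wordBasis.repr a = 0 := by
    apply h
    rw [← ha]
    conv_rhs => rw [← wordBasis.linearCombination_repr a, Finsupp.apply_linearCombination]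
    congr 2
    funext w
    simp [wordBasis_apply]
  simpa using h2

section Derivation

variable {A V : Type} [Ring A] [Algebra ℂ A] [AddCommGroup V] [Module ℂ V]

/-- The left action `a · (h ⊗ (x ⊗ y)) = h ⊗ (a x ⊗ y)` on `V ⊙ A ⊙ A`. -/
def leftAct (a : A) : V ⊗[ℂ] (A ⊗[ℂ] A) →ₗ[ℂ] V ⊗[ℂ] (A ⊗[ℂ] A) :=
  LinearMap.lTensor V (LinearMap.rTensor A (LinearMap.mulLeft ℂ a))

/-- The right action `(h ⊗ (x ⊗ y)) · b = h ⊗ (x ⊗ y b)` on `V ⊙ A ⊙ A`. -/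
def rightAct (b : A) : V ⊗[ℂ] (A ⊗[ℂ] A) →ₗ[ℂ] V ⊗[ℂ] (A ⊗[ℂ] A) :=
  LinearMap.lTensor V (LinearMap.lTensor A (LinearMap.mulRight ℂ b))

lemma leftAct_tmul (a x y : A) (h : V) :
    leftAct a (h ⊗ₜ[ℂ] (x ⊗ₜ[ℂ] y)) = h ⊗ₜ ((a * x) ⊗ₜ y) := rfl

lemma rightAct_tmul (b x y : A) (h : V) :
    rightAct b (h ⊗ₜ[ℂ] (x ⊗ₜ[ℂ] y)) = h ⊗ₜ (x ⊗ₜ (y * b)) := rfl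

lemma leftAct_add (a b : A) : leftAct (V := V) (a + b) = leftAct a + leftAct b := by
  ext h x y; simp [leftAct_tmul, add_mul, TensorProduct.add_tmul, TensorProduct.tmul_add]

lemma leftAct_smul (c : ℂ) (a : A) : leftAct (V := V) (c • a) = c • leftAct a := by
  ext h x y
  simp [leftAct_tmul, ← TensorProduct.smul_tmul']

lemma leftAct_one : leftAct (V := V) (1 : A) = LinearMap.id := by
  ext h x y; simp [leftAct_tmul]

lemma rightAct_one : rightAct (V := V) (1 : A) = LinearMap.id := by
  ext h x y; simp [rightAct_tmul]

lemma leftAct_mul (a b : A) (z : V ⊗[ℂ] (A ⊗[ℂ] A)) :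
    leftAct (a * b) z = leftAct a (leftAct b z) := by
  have : leftAct (V := V) (a * b) = leftAct a ∘ₗ leftAct b := by
    ext h x y; simp [leftAct_tmul, mul_assoc]
  rw [this]; rfl

lemma rightAct_add (a b : A) : rightAct (V := V) (a + b) = rightAct a + rightAct b := by
  ext h x y; simp [rightAct_tmul, mul_add, TensorProduct.tmul_add]

lemma rightAct_smul (c : ℂ) (a : A) : rightAct (V := V) (c • a) = c • rightAct a := by
  ext h x y; simp [rightAct_tmul]

lemma rightAct_leftAct (a b : A) (z : V ⊗[ℂ] (A ⊗[ℂ] A)) :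
    rightAct b (leftAct a z) = leftAct a (rightAct b z) := by
  have : rightAct b ∘ₗ leftAct (V := V) a = leftAct a ∘ₗ rightAct b := by
    ext h x y; simp [leftAct_tmul, rightAct_tmul]
  exact congrArg (fun φ : V ⊗[ℂ] (A ⊗[ℂ] A) →ₗ[ℂ] V ⊗[ℂ] (A ⊗[ℂ] A) => φ z) this

variable {κ : Type} (g : κ → A) (d : κ → V)

/-- The value on `g_{j₁} ⋯ g_{jₙ}` of the derivation with `g_j ↦ d_j ⊗ (1 ⊗ 1)`. -/
def wordDeriv : List κ → V ⊗[ℂ] (A ⊗[ℂ] A)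
  | [] => 0
  | j :: w => d j ⊗ₜ (1 ⊗ₜ (w.map g).prod) + leftAct (g j) (wordDeriv w)

lemma eq_wordDeriv {D : A →ₗ[ℂ] V ⊗[ℂ] (A ⊗[ℂ] A)} (h1 : ∀ j, D (g j) = d j ⊗ₜ (1 ⊗ₜ 1))
    (h2 : ∀ a b, D (a * b) = leftAct a (D b) + rightAct b (D a)) (w : List κ) :
    D (w.map g).prod = wordDeriv g d w := by
  induction w with
  | nil =>
    have h := h2 1 1
    rw [mul_one, leftAct_one, rightAct_one] at h
    simpa [wordDeriv] using h
  | cons j w ih =>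
    rw [List.map_cons, List.prod_cons, h2, ih, h1, rightAct_tmul, one_mul, wordDeriv, add_comm]

lemma exists_derivation (B : Module.Basis (List κ) ℂ A) (hB : ∀ w, B w = (w.map g).prod) :
    ∃ D : A →ₗ[ℂ] V ⊗[ℂ] (A ⊗[ℂ] A), (∀ j, D (g j) = d j ⊗ₜ (1 ⊗ₜ 1)) ∧
      ∀ a b, D (a * b) = leftAct a (D b) + rightAct b (D a) := by
  have hD : ∀ w, B.constr ℂ (wordDeriv g d) (w.map g).prod = wordDeriv g d w := fun w => by
    rw [← hB, B.constr_basis]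
  refine ⟨B.constr ℂ (wordDeriv g d), fun j => ?_, fun a b => ?_⟩
  · simpa [wordDeriv] using hD [j]
  have ha : a ∈ Submodule.span ℂ (Set.range B) := by rw [B.span_eq]; trivial
  have hb : b ∈ Submodule.span ℂ (Set.range B) := by rw [B.span_eq]; trivial
  generalize B.constr ℂ (wordDeriv g d) = D at hD ⊢
  induction ha using Submodule.span_induction with
  | mem x hx =>
    obtain ⟨u, rfl⟩ := hx
    induction hb using Submodule.span_induction with
    | mem x hx =>
      obtain ⟨w, rfl⟩ := hx
      rw [hB, hB, ← List.prod_append, ← List.map_append, hD, hD, hD]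
      induction u with
      | nil => simp [wordDeriv, leftAct_one]
      | cons j u ih =>
        rw [List.cons_append, wordDeriv, wordDeriv, ih, map_add, map_add, List.map_cons,
          List.prod_cons, leftAct_mul, rightAct_tmul, rightAct_leftAct, List.map_append,
          List.prod_append]
        abel
    | zero => rw [mul_zero, map_zero, map_zero, ← zero_smul ℂ (0 : A), rightAct_smul]; simp
    | add x y _ _ hx hy => rw [mul_add, map_add, hx, hy, map_add, map_add, rightAct_add,
        LinearMap.add_apply]; abel
    | smul c x _ hx => rw [mul_smul_comm, map_smul, hx, map_smul, map_smul, rightAct_smul,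
        LinearMap.smul_apply, smul_add]
  | zero => rw [zero_mul, map_zero, map_zero, ← zero_smul ℂ (0 : A), leftAct_smul]; simp
  | add x y _ _ hx hy => rw [add_mul, map_add, hx, hy, map_add, map_add, leftAct_add,
      LinearMap.add_apply]; abel
  | smul c x _ hx => rw [smul_mul_assoc, map_smul, hx, map_smul, map_smul, leftAct_smul,
      LinearMap.smul_apply, smul_add]

lemma map_of_basis (s : HR → A) (s_zero : s 0 = 0) (s_add : ∀ h k, s (h + k) = s h + s k)
    (s_smul : ∀ (r : ℝ) h, s (r • h) = (r : ℂ) • s h) (D : A →ₗ[ℂ] H ⊗[ℂ] (A ⊗[ℂ] A))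
    (hD : ∀ j, D (s (realBasis j)) = ofReal (realBasis j) ⊗ₜ (1 ⊗ₜ 1)) (h : HR) :
    D (s h) = ofReal h ⊗ₜ (1 ⊗ₜ 1) := by
  induction h using HR_induction with
  | basis j => exact hD j
  | zero => rw [s_zero, map_zero, map_zero, TensorProduct.zero_tmul]
  | add h k hh hk => rw [s_add, map_add, map_add, TensorProduct.add_tmul, hh, hk]
  | smul r h hh => rw [s_smul, ofReal_smul, ← TensorProduct.smul_tmul', ← hh, map_smul]

end Derivation

/-- The algebraic biprocesses `L²(ℝ₊) ⊙ 𝒮𝒞_alg ⊙ 𝒮𝒞_alg`, where `h ⊗ (a ⊗ b)` stands for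
`t ↦ h(t) a ⊗ b`. -/
abbrev Biprocess : Type := H ⊗[ℂ] (SCalg ⊗[ℂ] SCalg)

/-- The properties which characterise the free Malliavin derivative on `𝒮𝒞_alg`. -/
structure IsFreeMalliavin (D : SCalg →ₗ[ℂ] Biprocess) : Prop where
  map_S : ∀ h : HR, D (Salg h) = ofReal h ⊗ₜ (1 ⊗ₜ 1)
  leibniz : ∀ A B : SCalg, D (A * B) = leftAct A (D B) + rightAct B (D A)

theorem existsUnique_isFreeMalliavin : ∃! D : SCalg →ₗ[ℂ] Biprocess, IsFreeMalliavin D := by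
  obtain ⟨D, h1, h2⟩ := exists_derivation (fun j => Salg (realBasis j))
    (fun j => ofReal (realBasis j)) wordBasis (fun w => wordBasis_apply w)
  refine ⟨D, ⟨map_of_basis Salg Salg_zero Salg_add Salg_smul D h1, h2⟩,
    fun D' hD' => wordBasis.ext fun w => ?_⟩
  have e1 := eq_wordDeriv _ _ h1 h2 w
  have e2 := eq_wordDeriv (fun j => Salg (realBasis j)) _ (fun j => hD'.map_S _) hD'.leibniz w
  have e : wordBasis w = (w.map fun j => Salg (realBasis j)).prod := wordBasis_apply w
  rw [e, e1, e2]

/-- The free Malliavin derivative `∇` on `𝒮𝒞_alg`: the unique derivation with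
`∇ S(h) = h · 1 ⊗ 1` for real `h`. -/
def freeMalliavin : SCalg →ₗ[ℂ] Biprocess := existsUnique_isFreeMalliavin.choose

lemma isFreeMalliavin_freeMalliavin : IsFreeMalliavin freeMalliavin :=
  existsUnique_isFreeMalliavin.choose_spec.1

section Iterated

variable (A : Type) [Ring A] [Algebra ℂ A]

/-- Algebraic multiprocesses `L²(ℝ₊ⁿ) ⊙ A^{⊙ n} ⊙ A` with `n + 1` legs in `A`, the last leg being
kept apart; `f ⊗ (x₁ ⊗ … ⊗ xₙ) ⊗ y` stands for `t ↦ f(t) x₁ ⊗ … ⊗ xₙ ⊗ y`. -/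
abbrev Multiprocess (n : ℕ) : Type := (L2 n ⊗[ℂ] ⨂[ℂ]^n A) ⊗[ℂ] A

/-- `(x₁ ⊗ … ⊗ xₙ) ⊗ y ↦ x₁ ⊗ … ⊗ xₙ ⊗ y`. -/
def snocTensor (n : ℕ) : (⨂[ℂ]^n A) ⊗[ℂ] A →ₗ[ℂ] ⨂[ℂ]^(n + 1) A :=
  TensorPower.mulEquiv.toLinearMap ∘ₗ
    LinearMap.lTensor (⨂[ℂ]^n A)
      (PiTensorProduct.subsingletonEquiv (R := ℂ) (s := fun _ : Fin 1 => A) 0).symm.toLinearMap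

variable {A}

lemma snocTensor_tprod (n : ℕ) (x : Fin n → A) (y : A) :
    snocTensor A n (PiTensorProduct.tprod ℂ x ⊗ₜ y) =
      PiTensorProduct.tprod ℂ (Fin.snoc (α := fun _ => A) x y) := by
  have h : (PiTensorProduct.subsingletonEquiv (R := ℂ) (s := fun _ : Fin 1 => A) 0).symm y =
      PiTensorProduct.tprod ℂ (fun _ : Fin 1 => y) := by
    rw [LinearEquiv.symm_apply_eq]; simp
  change TensorPower.mulEquiv (PiTensorProduct.tprod ℂ x ⊗ₜ
    (PiTensorProduct.subsingletonEquiv (R := ℂ) (s := fun _ : Fin 1 => A) 0).symm y) = _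
  rw [h]
  refine (TensorPower.tprod_mul_tprod ℂ x (fun _ : Fin 1 => y)).trans ?_
  rw [Fin.append_right_eq_snoc]

variable (D : A →ₗ[ℂ] H ⊗[ℂ] (A ⊗[ℂ] A))

/-- The operator `id^{⊗ n} ⊗ D_{tₙ₊₁}`: the last leg `y`, with `D y = ∑ h ⊗ (a ⊗ b)`, is replaced
by the two legs `a ⊗ b`, and `h` takes the new last variable. -/
def derivLastLeg (n : ℕ) : Multiprocess A n →ₗ[ℂ] Multiprocess A (n + 1) :=
  LinearMap.rTensor A
      (TensorProduct.map (TensorProduct.lift (insertVar (Fin.last n)).flip) (snocTensor A n) ∘ₗ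
        (TensorProduct.tensorTensorTensorComm ℂ (L2 n) (⨂[ℂ]^n A) H A).toLinearMap) ∘ₗ
    (TensorProduct.assoc ℂ (L2 n ⊗[ℂ] ⨂[ℂ]^n A) (H ⊗[ℂ] A) A).symm.toLinearMap ∘ₗ
    LinearMap.lTensor (L2 n ⊗[ℂ] ⨂[ℂ]^n A)
      ((TensorProduct.assoc ℂ H A A).symm.toLinearMap ∘ₗ D)

lemma derivLastLeg_tmul (n : ℕ) (f : L2 n) (x : ⨂[ℂ]^n A) (y a b : A) (h : H)
    (hy : D y = h ⊗ₜ (a ⊗ₜ b)) : derivLastLeg D n ((f ⊗ₜ x) ⊗ₜ y) =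
      (insertVar (Fin.last n) h f ⊗ₜ snocTensor A n (x ⊗ₜ a)) ⊗ₜ b := by
  simp [derivLastLeg, hy]

/-- The iterated derivative `Dⁿ = (id^{⊗ (n-1)} ⊗ D_{tₙ}) ∘ … ∘ (id ⊗ D_{t₂}) ∘ D_{t₁}`. -/
def iteratedDerivation : (n : ℕ) → A →ₗ[ℂ] Multiprocess A n
  | 0 => TensorProduct.mk ℂ _ _ (oneL2 ⊗ₜ PiTensorProduct.tprod ℂ Fin.elim0)
  | n + 1 => derivLastLeg D n ∘ₗ iteratedDerivation n

end Iterated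

/-- The iterated free Malliavin derivative
`∇ⁿ = (id^{⊗ (n-1)} ⊗ ∇_{tₙ}) ∘ … ∘ (id ⊗ ∇_{t₂}) ∘ ∇_{t₁}` on `𝒮𝒞_alg`. -/
def iteratedMalliavin (n : ℕ) : SCalg →ₗ[ℂ] Multiprocess SCalg n :=
  iteratedDerivation freeMalliavin n

/-- The Hilbert space `L²(𝒮𝒞^{⊗ n}, τ^{⊗ n}) = L²(𝒮𝒞, τ)^{⊗ n}`. -/
abbrev L2SCpow (n : ℕ) : Type := HilbertTensorPower L2SC n

/-- The Hilbert space `L²(ℝ₊ᵖ, L²(𝒮𝒞^{⊗ (p + 1)}))`. -/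
abbrev M2 (p : ℕ) : Type := Lp (L2SCpow (p + 1)) 2 (orthant p)

/-- The function `t ↦ f(t) • v`. -/
def scalarTimes (p : ℕ) : L2 p →ₗ[ℂ] L2SCpow (p + 1) →ₗ[ℂ] M2 p :=
  LinearMap.mk₂ ℂ (fun f v => (ContinuousLinearMap.toSpanSingleton ℂ v).compLp f)
    (fun f g v => map_add ((ContinuousLinearMap.toSpanSingleton ℂ v).compLpL 2 (orthant p)) f g)
    (fun c f v => map_smul ((ContinuousLinearMap.toSpanSingleton ℂ v).compLpL 2 (orthant p)) c f)
    (fun f v w => by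
      rw [← ContinuousLinearMap.add_compLp]
      congr 1
      ext; simp)
    (fun c f v => by
      rw [← ContinuousLinearMap.smul_compLp]
      congr 1
      ext; simp)

lemma scalarTimes_coeFn (p : ℕ) (f : L2 p) (v : L2SCpow (p + 1)) :
    scalarTimes p f v =ᵐ[orthant p] fun t => f t • v :=
  (ContinuousLinearMap.toSpanSingleton ℂ v).coeFn_compLp f

/-- An algebraic multiprocess, with legs sent to `L²(𝒮𝒞)` by `j`, as an element of
`L²(ℝ₊ᵖ, L²(𝒮𝒞^{⊗ (p + 1)}))`. -/
def multiprocessToM2 {A : Type} [Ring A] [Algebra ℂ A] (j : A →ₗ[ℂ] L2SC) (p : ℕ) :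
    Multiprocess A p →ₗ[ℂ] M2 p :=
  TensorProduct.lift (scalarTimes p) ∘ₗ
    LinearMap.lTensor (L2 p)
      (ofTensor L2SC (p + 1) ∘ₗ PiTensorProduct.map (fun _ => j) ∘ₗ snocTensor A p) ∘ₗ
    (TensorProduct.assoc ℂ (L2 p) (⨂[ℂ]^p A) A).toLinearMap

/-- The free Malliavin derivative `∇ᵖ` of order `p` as an unbounded operator from `L²(𝒮𝒞)` to
`L²(ℝ₊ᵖ, L²(𝒮𝒞^{⊗ (p + 1)}))` with domain `𝒮𝒞_alg` (passing to its closure does not change the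
adjoint). -/
def nabla (p : ℕ) : L2SC →ₗ.[ℂ] M2 p where
  domain := LinearMap.range algToL2
  toFun := multiprocessToM2 algToL2 p ∘ₗ iteratedMalliavin p ∘ₗ
    (LinearEquiv.ofInjective algToL2 algToL2_injective).symm.toLinearMap

lemma nabla_apply (p : ℕ) (F : SCalg) :
    nabla p ⟨algToL2 F, F, rfl⟩ = multiprocessToM2 algToL2 p (iteratedMalliavin p F) := by
  have : (LinearEquiv.ofInjective algToL2 algToL2_injective).symm ⟨algToL2 F, F, rfl⟩ = F :=
    (LinearEquiv.symm_apply_eq _).2 rfl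
  change multiprocessToM2 algToL2 p (iteratedMalliavin p
    ((LinearEquiv.ofInjective algToL2 algToL2_injective).symm ⟨algToL2 F, F, rfl⟩)) = _
  rw [this]

/-- The free Skorohod integral `δᵖ` of order `p`: the adjoint of `∇ᵖ`. -/
def freeSkorohod (p : ℕ) : M2 p →ₗ.[ℂ] L2SC := (nabla p).adjoint

/-- The element `1^{⊗ n}` of `L²(𝒮𝒞^{⊗ n})`. -/
def onePow (n : ℕ) : L2SCpow n :=
  ofTensor L2SC n (PiTensorProduct.tprod ℂ fun _ => algToL2 1)

/-- The deterministic multiprocess `f · 1^{⊗ (p + 1)}`. -/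
def deterministic (p : ℕ) (f : L2 p) : M2 p := scalarTimes p f (onePow (p + 1))

lemma halfLine_Icc_ne_top (a b : ℝ) : halfLine (Set.Icc a b) ≠ ⊤ :=
  ((Measure.restrict_apply_le _ _).trans_lt measure_Icc_lt_top).ne

/-- The free Brownian motion `S_t = S(1_{[0, t]})`. -/
def brownian (t : ℝ) : SCalg :=
  Salg (indicatorConstLp 2 (s := Set.Icc 0 t) measurableSet_Icc
    (halfLine_Icc_ne_top 0 t) 1)

/-- The rectangle `[u₁, v₁] × … × [uₙ, vₙ]`. -/
def box {n : ℕ} (u v : Fin n → ℝ) : Set (Fin n → ℝ) := Set.univ.pi fun i => Set.Icc (u i) (v i)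

/-- The collection of diagonals `{t : tᵢ = tⱼ for some i ≠ j}`. -/
def diagonals (n : ℕ) : Set (Fin n → ℝ) := {t | ∃ i j, i ≠ j ∧ t i = t j}

lemma measurableSet_box {n : ℕ} (u v : Fin n → ℝ) : MeasurableSet (box u v) :=
  MeasurableSet.univ_pi fun _ => measurableSet_Icc

lemma box_ne_top {n : ℕ} (u v : Fin n → ℝ) : orthant n (box u v) ≠ ⊤ := by
  rw [box, Measure.pi_pi]
  exact ENNReal.prod_ne_top fun i _ => halfLine_Icc_ne_top _ _

/-- The indicator function of a rectangle, in `L²(ℝ₊ⁿ)`. -/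
def boxIndicator {n : ℕ} (u v : Fin n → ℝ) : L2 n :=
  indicatorConstLp 2 (measurableSet_box u v) (box_ne_top u v) 1

/-- The product `(S_{v₁} - S_{u₁}) ⋯ (S_{vₙ} - S_{uₙ})`. -/
def brownianProduct {n : ℕ} (u v : Fin n → ℝ) : SCalg :=
  (List.ofFn fun i => brownian (v i) - brownian (u i)).prod

/-- The property which characterises the multiple Wigner integral `I_n`: it is linear and
continuous on `L²(ℝ₊ⁿ)`, and the indicator function of a rectangle `[u₁, v₁] × … × [uₙ, vₙ]` off
the diagonals goes to `(S_{v₁} - S_{u₁}) ⋯ (S_{vₙ} - S_{uₙ})`. -/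
def IsWignerIntegral (n : ℕ) (I : L2 n →L[ℂ] L2SC) : Prop :=
  ∀ u v : Fin n → ℝ, (∀ i, 0 ≤ u i ∧ u i ≤ v i) → Disjoint (box u v) (diagonals n) →
    I (boxIndicator u v) = algToL2 (brownianProduct u v)

/-- The indicator function of an interval, in `L²(ℝ₊)`. -/
def intervalIndicator (a b : ℝ) : H :=
  indicatorConstLp 2 (s := Set.Icc a b) measurableSet_Icc (halfLine_Icc_ne_top a b) 1

lemma ofReal_brownian_sub {a b : ℝ} (ha : 0 ≤ a) (hab : a ≤ b) :
    ofReal (indicatorConstLp 2 (s := Set.Icc 0 b) measurableSet_Icc (halfLine_Icc_ne_top 0 b) 1 -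
      indicatorConstLp 2 (s := Set.Icc 0 a) measurableSet_Icc (halfLine_Icc_ne_top 0 a) 1) =
      intervalIndicator a b := by
  refine Lp.ext ?_
  have hne : ∀ᵐ t ∂halfLine, t ≠ a := by
    refine ae_restrict_of_ae ?_
    simp [ae_iff]
  filter_upwards [ofReal_coeFn (indicatorConstLp 2 (s := Set.Icc 0 b) measurableSet_Icc
      (halfLine_Icc_ne_top 0 b) 1 - indicatorConstLp 2 (s := Set.Icc 0 a) measurableSet_Icc
      (halfLine_Icc_ne_top 0 a) 1),
    Lp.coeFn_sub (indicatorConstLp 2 (s := Set.Icc 0 b) measurableSet_Icc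
      (halfLine_Icc_ne_top 0 b) (1 : ℝ)) (indicatorConstLp 2 (s := Set.Icc 0 a) measurableSet_Icc
      (halfLine_Icc_ne_top 0 a) (1 : ℝ)),
    indicatorConstLp_coeFn (p := 2) (hs := measurableSet_Icc) (hμs := halfLine_Icc_ne_top 0 b)
      (c := (1 : ℝ)),
    indicatorConstLp_coeFn (p := 2) (hs := measurableSet_Icc) (hμs := halfLine_Icc_ne_top 0 a)
      (c := (1 : ℝ)),
    indicatorConstLp_coeFn (p := 2) (hs := measurableSet_Icc) (hμs := halfLine_Icc_ne_top a b)
      (c := (1 : ℂ)), hne] with t h1 h2 h3 h4 h5 h6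
  rw [h1, h2, Pi.sub_apply, h3, h4]
  refine Eq.trans ?_ h5.symm
  simp only [Set.indicator, Set.mem_Icc]
  by_cases c1 : 0 ≤ t <;> by_cases c2 : t ≤ b <;> by_cases c3 : t ≤ a
  · have : ¬ a ≤ t := fun h => h6 (le_antisymm c3 h)
    simp [c1, c2, c3, this]
  · simp [c1, c2, c3, (not_le.1 c3).le]
  · exact absurd (c3.trans hab) c2
  · simp [c2, c3]
  · have : ¬ a ≤ t := fun h => c1 (ha.trans h)
    simp [c1, this]
  · exact absurd (c1 (ha.trans (not_le.1 c3).le)) id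
  · exact absurd (c3.trans hab) c2
  · simp [c1, c2]

lemma brownian_sub_apply {a b : ℝ} (ha : 0 ≤ a) (hab : a ≤ b) (x : Fock) :
    ((brownian b - brownian a : SCalg) : Fock →L[ℂ] Fock) x =
      creation (intervalIndicator a b) x + annihilation (intervalIndicator a b) x := by
  have h : ∀ h k : HR, S h - S k = S (h - k) := fun h k => by
    rw [sub_eq_iff_eq_add, ← S_add, sub_add_cancel]
  have e : ((brownian b - brownian a : SCalg) : Fock →L[ℂ] Fock) =
      creation (intervalIndicator a b) + annihilation (intervalIndicator a b) := by
    rw [← ofReal_brownian_sub ha hab]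
    exact h _ _
  rw [e]
  rfl

lemma boxIndicator_succ {n : ℕ} (u v : Fin (n + 1) → ℝ) :
    insertVar 0 (intervalIndicator (u 0) (v 0)) (boxIndicator (Fin.tail u) (Fin.tail v)) =
      boxIndicator u v := by
  refine Lp.ext ?_
  have h1 := insertVar_coeFn 0 (intervalIndicator (u 0) (v 0))
    (boxIndicator (Fin.tail u) (Fin.tail v))
  have h2 := (eval_qmp (n := n) 0).ae (indicatorConstLp_coeFn (p := 2)
    (hs := measurableSet_Icc) (hμs := halfLine_Icc_ne_top (u 0) (v 0)) (c := (1 : ℂ)))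
  have h3 := (removeNth_qmp (n := n) 0).ae (indicatorConstLp_coeFn (p := 2)
    (hs := measurableSet_box (Fin.tail u) (Fin.tail v)) (hμs := box_ne_top _ _) (c := (1 : ℂ)))
  have h4 := indicatorConstLp_coeFn (p := 2)
    (hs := measurableSet_box u v) (hμs := box_ne_top _ _) (c := (1 : ℂ))
  filter_upwards [h1, h2, h3, h4] with t h1 h2 h3 h4
  rw [h1]
  refine Eq.trans ?_ h4.symm
  refine (congrArg₂ (· * ·) h2 h3).trans ?_
  have hiff : t ∈ box u v ↔ t 0 ∈ Set.Icc (u 0) (v 0) ∧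
      (Fin.removeNth 0 t) ∈ box (Fin.tail u) (Fin.tail v) := by
    simp only [box, Set.mem_univ_pi]
    rw [Fin.forall_fin_succ]
    rfl
  by_cases hc : t ∈ box u v
  · obtain ⟨ha, hb⟩ := hiff.1 hc
    rw [Set.indicator_of_mem hc, Set.indicator_of_mem ha, Set.indicator_of_mem hb, mul_one]
  · rw [Set.indicator_of_notMem hc]
    by_cases ha : t 0 ∈ Set.Icc (u 0) (v 0)
    · rw [Set.indicator_of_notMem fun hb => hc (hiff.2 ⟨ha, hb⟩), mul_zero]
    · rw [Set.indicator_of_notMem ha, zero_mul]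

lemma boxIndicator_zero (u v : Fin 0 → ℝ) : boxIndicator u v = oneL2 := by
  refine Lp.ext ?_
  have h1 := MemLp.coeFn_toLp (memLp_const (1 : ℂ) : MemLp (fun _ => (1 : ℂ)) 2 (orthant 0))
  have h2 := indicatorConstLp_coeFn (p := 2)
    (hs := measurableSet_box u v) (hμs := box_ne_top _ _) (c := (1 : ℂ))
  filter_upwards [h1, h2] with t h1 h2
  refine h2.trans (Eq.trans ?_ h1.symm)
  simp [box]

lemma inner_intervalIndicator {a b c d : ℝ} (h : Disjoint (Set.Icc a b) (Set.Icc c d)) :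
    inner ℂ (intervalIndicator a b) (intervalIndicator c d) = 0 := by
  rw [L2.inner_def]
  refine integral_eq_zero_of_ae ?_
  have h1 := indicatorConstLp_coeFn (p := 2)
    (hs := measurableSet_Icc) (hμs := halfLine_Icc_ne_top a b) (c := (1 : ℂ))
  have h2 := indicatorConstLp_coeFn (p := 2)
    (hs := measurableSet_Icc) (hμs := halfLine_Icc_ne_top c d) (c := (1 : ℂ))
  filter_upwards [h1, h2] with t h1 h2
  refine (congrArg₂ (fun x y => inner ℂ x y) h1 h2).trans ?_
  by_cases ha : t ∈ Set.Icc a b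
  · have hb : t ∉ Set.Icc c d := Set.disjoint_left.1 h ha
    simp only [Set.indicator, if_neg hb, inner_zero_right]; rfl
  · simp only [Set.indicator, if_neg ha, inner_zero_left]; rfl

lemma disjoint_of_offDiagonal {n : ℕ} {u v : Fin n → ℝ} (huv : ∀ i, 0 ≤ u i ∧ u i ≤ v i)
    (h : Disjoint (box u v) (diagonals n)) {i j : Fin n} (hij : i ≠ j) :
    Disjoint (Set.Icc (u i) (v i)) (Set.Icc (u j) (v j)) := by
  rw [Set.disjoint_left]
  intro x hi hj
  have hmem : (fun k => if k = i ∨ k = j then x else u k) ∈ box u v := by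
    intro k _
    by_cases hk : k = i ∨ k = j
    · rcases hk with rfl | rfl
      · simpa using hi
      · simpa using hj
    · simpa [hk] using (huv k).2
  exact Set.disjoint_left.1 h hmem ⟨i, j, hij, by simp⟩

lemma brownianProduct_vacuum {n : ℕ} (u v : Fin n → ℝ) (huv : ∀ i, 0 ≤ u i ∧ u i ≤ v i)
    (h : ∀ i j, i ≠ j → Disjoint (Set.Icc (u i) (v i)) (Set.Icc (u j) (v j))) :
    (brownianProduct u v : Fock →L[ℂ] Fock) vacuum = level n (boxIndicator u v) := by
  induction n with
  | zero =>
    rw [boxIndicator_zero]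
    have : brownianProduct u v = 1 := by simp [brownianProduct]
    rw [this]; rfl
  | succ n ih =>
    have e : brownianProduct u v = (brownian (v 0) - brownian (u 0)) *
        brownianProduct (Fin.tail u) (Fin.tail v) := by
      rw [brownianProduct, List.ofFn_succ, List.prod_cons]; rfl
    have e2 : (brownianProduct u v : Fock →L[ℂ] Fock) vacuum =
        ((brownian (v 0) - brownian (u 0) : SCalg) : Fock →L[ℂ] Fock)
          ((brownianProduct (Fin.tail u) (Fin.tail v) : Fock →L[ℂ] Fock) vacuum) := by
      rw [e]; rfl
    rw [e2, ih (Fin.tail u) (Fin.tail v) (fun i => huv i.succ)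
      (fun i j hij => h i.succ j.succ (fun e => hij (Fin.succ_injective _ e))),
      brownian_sub_apply (huv 0).1 (huv 0).2, creation_level, boxIndicator_succ]
    have z : annihilation (intervalIndicator (u 0) (v 0))
        (level n (boxIndicator (Fin.tail u) (Fin.tail v))) = 0 := by
      cases n with
      | zero =>
        have hd : DegLT 1 (level 0 (boxIndicator (Fin.tail u) (Fin.tail v))) :=
          fun m hm => level_apply_ne (by omega) _
        exact (hd.annihilation _).eq_zero
      | succ n =>
        rw [← boxIndicator_succ, ← creation_level, annihilation_creation,
          inner_intervalIndicator (c := Fin.tail u 0) (d := Fin.tail v 0) (h 0 1 (by simp)),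
          zero_smul]
    rw [z, add_zero]

lemma exists_isWignerIntegral (n : ℕ) : ∃ I : L2 n →L[ℂ] L2SC, IsWignerIntegral n I := by
  refine ⟨L2SCsub.orthogonalProjectionOnto ∘L level n, fun u v huv h => ?_⟩
  have e := brownianProduct_vacuum u v huv fun i j hij => disjoint_of_offDiagonal huv h hij
  change L2SCsub.orthogonalProjectionOnto (level n (boxIndicator u v)) = _
  rw [← e]
  exact Submodule.orthogonalProjectionOnto_mem_subspace_eq_self (algToL2 (brownianProduct u v))

lemma volume_setOf_eq_zero {n : ℕ} (φ : (Fin n → ℝ) →ₗ[ℝ] ℝ) (hφ : φ ≠ 0) :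
    ∀ᵐ x : Fin n → ℝ, φ x ≠ 0 := by
  have h := Measure.addHaar_submodule (volume : Measure (Fin n → ℝ)) (LinearMap.ker φ)
    (fun h => hφ (LinearMap.ker_eq_top.1 h))
  have e : {x | ¬ φ x ≠ 0} = (LinearMap.ker φ : Set (Fin n → ℝ)) := by ext; simp
  rw [ae_iff, e, h]

lemma orthant_eq (n : ℕ) : orthant n =
    (volume : Measure (Fin n → ℝ)).restrict (Set.univ.pi fun _ => Set.Ici 0) := by
  rw [volume_pi, Measure.restrict_pi_pi]

lemma inner_boxIndicator {n : ℕ} (u v : Fin n → ℝ) (g : L2 n) :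
    inner ℂ (boxIndicator u v) g = ∫ t in box u v, g t ∂(orthant n) :=
  L2.inner_indicatorConstLp_one (measurableSet_box u v) (box_ne_top u v) g

/-- The indicator functions of rectangles off the diagonals span a dense subspace of `L²(ℝ₊ⁿ)`. -/
lemma eq_zero_of_inner_boxIndicator {n : ℕ} (g : L2 n)
    (hg : ∀ u v : Fin n → ℝ, (∀ i, 0 ≤ u i ∧ u i ≤ v i) → Disjoint (box u v) (diagonals n) →
      inner ℂ (boxIndicator u v) g = 0) : g = 0 := by
  set C : Set (Fin n → ℝ) := Set.univ.pi fun _ => Set.Ici 0 with hC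
  have hCm : MeasurableSet C := MeasurableSet.univ_pi fun _ => measurableSet_Ici
  have hloc : LocallyIntegrable (C.indicator g) (volume : Measure (Fin n → ℝ)) := by
    have h1 : MemLp g 2 ((volume : Measure (Fin n → ℝ)).restrict C) := by
      rw [← orthant_eq]; exact Lp.memLp g
    exact ((memLp_indicator_iff_restrict hCm).2 h1).locallyIntegrable (by norm_num)
  have hdiag : ∀ᵐ x : Fin n → ℝ, ∀ i j, i ≠ j → x i ≠ x j := by
    simp only [ae_all_iff]
    intro i j hij
    have := volume_setOf_eq_zero (LinearMap.proj (R := ℝ) (φ := fun _ : Fin n => ℝ) i -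
      LinearMap.proj j) (fun h => by
        have := congrArg (fun φ : (Fin n → ℝ) →ₗ[ℝ] ℝ => φ (Pi.single i 1)) h
        simp [hij.symm] at this)
    filter_upwards [this] with x hx
    simpa [sub_eq_zero] using hx
  have hpos : ∀ᵐ x : Fin n → ℝ, ∀ i, x i ≠ 0 := by
    simp only [ae_all_iff]
    intro i
    have := volume_setOf_eq_zero (LinearMap.proj (R := ℝ) (φ := fun _ : Fin n => ℝ) i)
      (fun h => by
        have := congrArg (fun φ : (Fin n → ℝ) →ₗ[ℝ] ℝ => φ (Pi.single i 1)) h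
        simp at this)
    filter_upwards [this] with x hx
    simpa using hx
  have hmain : ∀ᵐ x : Fin n → ℝ, x ∈ C → g x = 0 := by
    filter_upwards [hdiag, hpos, IsUnifLocDoublingMeasure.ae_tendsto_average volume hloc 1]
      with x h1 h2 h3 hxC
    have hx0 : ∀ i, 0 < x i := fun i => lt_of_le_of_ne (hxC i trivial) (h2 i).symm
    have hlim := h3 (l := nhdsWithin (0 : ℝ) (Set.Ioi 0)) (fun _ => x) id Filter.tendsto_id (by
      filter_upwards [self_mem_nhdsWithin] with r hr
      simpa using (le_of_lt hr : (0 : ℝ) ≤ r))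
    have hev : ∀ᶠ r in nhdsWithin (0 : ℝ) (Set.Ioi 0),
        ⨍ y in Metric.closedBall x (id r), C.indicator g y = 0 := by
      have e1 : ∀ᶠ r in nhdsWithin (0 : ℝ) (Set.Ioi 0), ∀ i, r < x i :=
        Filter.eventually_all.2 fun i => nhdsWithin_le_nhds (gt_mem_nhds (hx0 i))
      have e2 : ∀ᶠ r in nhdsWithin (0 : ℝ) (Set.Ioi 0), ∀ i j, i ≠ j → 2 * r < |x i - x j| := by
        refine Filter.eventually_all.2 fun i => Filter.eventually_all.2 fun j => ?_
        by_cases hij : i = j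
        · simp [hij]
        have hp : 0 < |x i - x j| / 2 := by
          have := abs_pos.2 (sub_ne_zero.2 (h1 i j hij)); positivity
        filter_upwards [nhdsWithin_le_nhds (gt_mem_nhds hp)] with r hr _
        linarith
      filter_upwards [e1, e2, self_mem_nhdsWithin] with r hr1 hr2 hr
      have hr0 : (0 : ℝ) < r := hr
      have hball : Metric.closedBall x (id r) = box (fun i => x i - r) (fun i => x i + r) := by
        change Metric.closedBall x r = _
        rw [closedBall_pi x hr0.le]
        simp only [box, Real.closedBall_eq_Icc]
      have hbC : box (fun i => x i - r) (fun i => x i + r) ⊆ C := fun y hy i _ => by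
        have := (hy i trivial).1
        have := hr1 i
        simp only [Set.mem_Ici]; linarith
      have hz := hg (fun i => x i - r) (fun i => x i + r)
        (fun i => ⟨by linarith [hr1 i], by linarith⟩) (by
          rw [Set.disjoint_left]
          rintro y hy ⟨i, j, hij, hyij⟩
          have hi := hy i trivial
          have hj := hy j trivial
          have := hr2 i j hij
          simp only [Set.mem_Icc] at hi hj
          rcases abs_cases (x i - x j) with ⟨ha, _⟩ | ⟨ha, _⟩ <;> linarith [hi.1, hi.2, hj.1, hj.2])
      rw [inner_boxIndicator] at hz
      replace hz := (congrArg (fun m => ∫ t in box (fun i => x i - r) (fun i => x i + r),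
        (g : (Fin n → ℝ) → ℂ) t ∂m) (orthant_eq n)).symm.trans hz
      simp only [Measure.restrict_restrict (measurableSet_box (fun i => x i - r)
        (fun i => x i + r)), ← hC, Set.inter_eq_left.2 hbC] at hz
      rw [hball, setAverage_eq, setIntegral_congr_fun (measurableSet_box _ _)
        (fun y hy => Set.indicator_of_mem (hbC hy) g), hz, smul_zero]
    have hlim0 := tendsto_nhds_unique hlim (tendsto_const_nhds.congr' (hev.mono fun _ h => h.symm))
    rwa [Set.indicator_of_mem hxC] at hlim0
  refine Lp.ext ?_
  refine Filter.EventuallyEq.trans ?_ (Lp.coeFn_zero ℂ 2 (orthant n)).symm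
  exact (congrArg (fun m => (g : (Fin n → ℝ) → ℂ) =ᵐ[m] 0) (orthant_eq n)).mpr
    ((ae_restrict_iff' hCm).2 hmain)

theorem existsUnique_isWignerIntegral (n : ℕ) :
    ∃! I : L2 n →L[ℂ] L2SC, IsWignerIntegral n I := by
  obtain ⟨I, hI⟩ := exists_isWignerIntegral n
  refine ⟨I, hI, fun J hJ => ?_⟩
  have key : ∀ F : L2SC, ContinuousLinearMap.adjoint (J - I) F = 0 := fun F =>
    eq_zero_of_inner_boxIndicator _ fun u v huv h => by
      rw [ContinuousLinearMap.adjoint_inner_right, sub_apply, hJ u v huv h,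
        hI u v huv h, sub_self, inner_zero_left]
  ext1 f
  rw [← sub_eq_zero, ← sub_apply, ← inner_self_eq_zero (𝕜 := ℂ),
    ← ContinuousLinearMap.adjoint_inner_right, key, inner_zero_right]

/-- The multiple Wigner integral `I_n`. -/
def wignerIntegral (n : ℕ) : L2 n →L[ℂ] L2SC := (existsUnique_isWignerIntegral n).choose

lemma isWignerIntegral_wignerIntegral (n : ℕ) : IsWignerIntegral n (wignerIntegral n) :=
  (existsUnique_isWignerIntegral n).choose_spec.1

end FreeWigner

end

/-! By definition of the adjoint, the claim is the duality `⟨I_p(f), FΩ⟩ = ⟨f · 1 ⊗ ⋯ ⊗ 1, ∇ᵖF⟩` for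
all `F` in `𝒮𝒞_alg` (inner products linear in the second slot), together with the density of `𝒮𝒞_alg
Ω`, which makes the representing vector unique.

Both sides depend continuously and conjugate-linearly on `f`, and indicators of rectangles off the
diagonals are total in `L²(ℝ₊ᵖ)`, so `f` may be the indicator of such a rectangle, with sides `e₁,
…, e_p` (indicators of intervals). There the Wigner integral is a product of increments with
disjoint sides; applied to `Ω`, only its creation parts survive, and the left side becomes `⟨l(e₁) ⋯
l(e_p)Ω, FΩ⟩ = ⟨Ω, l*(e_p) ⋯ l*(e₁) FΩ⟩`.

The bridge to `∇` is the formula `l*(h) FΩ = (⟨h, ·⟩ ⊗ τ ⊗ id)(∇F) Ω` (`annihilation_applyVacuum`):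
annihilation on `𝒮𝒞_alg Ω` is the derivative with its time variable paired with `h` and its first
leg averaged. Since `∇ᵖ` always differentiates the last leg, iteration gives `l*(e_p) ⋯ l*(e₁) FΩ =
(⟨e₁ ⊗ ⋯ ⊗ e_p, ·⟩ ⊗ τ^{⊗p} ⊗ id)(∇ᵖF) Ω` (`collapse_iteratedMalliavin`). Pairing with `Ω` averages
the last leg as well, which is exactly the pairing of `∇ᵖF` with the deterministic multiprocess.

The bridge is proved by induction on words. For `F = S(b)G`, the relation `l*(h)l(b) = ⟨h, b⟩` gives
`l*(h)FΩ = ⟨h, b⟩GΩ + l*(h)l*(b)GΩ`, while Leibniz gives `⟨h, b⟩GΩ` plus the contraction of `∇G`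
with `τ(S(b) ·)` on its first leg. As `τ(S(b)a) = ⟨Ω, l*(b)aΩ⟩`, the induction hypothesis turns this
functional into a contraction of `∇a`; the coassociativity `(∇ ⊗ id)∇ = (id ⊗ ∇)∇`
(`contract_coassoc`) moves the second derivative to the other leg, where the induction hypothesis
reads it as `l*(h)`. -/

noncomputable section

namespace FreeWigner

/-! ### Density of the algebraic vectors -/

/-- The vectors `F Ω` with `F` in `𝒮𝒞_alg` are dense in `L²(𝒮𝒞, τ)`. -/
lemma denseRange_algToL2 : DenseRange algToL2 := by
  set K₀ : Submodule ℂ Fock := SCalg.toSubalgebra.toSubmodule.map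
    (ContinuousLinearMap.apply ℂ Fock vacuum).toLinearMap with hK₀
  set K : Submodule ℂ Fock := K₀.topologicalClosure with hK
  have : CompleteSpace K := K₀.isClosed_topologicalClosure.completeSpace_coe
  have hinv : ∀ h : HR, K ≤ K.comap (S h).toLinearMap := fun h => by
    refine Submodule.topologicalClosure_minimal _ ?_
      (K₀.isClosed_topologicalClosure.preimage (S h).continuous)
    rintro _ ⟨X, hX, rfl⟩
    exact Submodule.le_topologicalClosure _ ⟨S h * X, SCalg.mul_mem (Salg h).2 hX, rfl⟩
  -- `K` is invariant under the self-adjoint operator `S h`, hence so is its orthogonal complement,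
  -- and the projection onto `K` commutes with `S h`.
  have hcomm : ∀ h : HR, S h * K.starProjection = K.starProjection * S h := fun h => by
    ext1 x
    change S h (K.starProjection x) = K.starProjection (S h x)
    have e1 : S h (K.starProjection x) ∈ K := hinv h (K.starProjection_apply_mem x)
    have e2 : S h (x - K.starProjection x) ∈ Kᗮ := fun y hy => by
      have hsa : ContinuousLinearMap.adjoint (S h) = S h := star_S h
      rw [← ContinuousLinearMap.adjoint_inner_left, hsa]
      exact K.sub_starProjection_mem_orthogonal x _ (hinv h hy)
    have e3 : S h x = S h (K.starProjection x) + S h (x - K.starProjection x) := by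
      rw [map_sub]; abel
    rw [e3, map_add, Submodule.starProjection_eq_self_iff.2 e1,
      (Submodule.starProjection_apply_eq_zero_iff K).2 e2, add_zero]
  have hvac : vacuum ∈ K := Submodule.le_topologicalClosure _ ⟨1, SCalg.one_mem, rfl⟩
  have hSC : ∀ X ∈ SC.toStarSubalgebra, X vacuum ∈ K := fun X hX => by
    have hX' : X ∈ (SC : Set (Fock →L[ℂ] Fock)) := hX
    rw [coe_SC] at hX'
    -- The projection `P` onto `K` lies in the commutant of the `S h`, so `X`, in the bicommutant,
    -- commutes with it: `XΩ = XPΩ = PXΩ` is in `K`.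
    have hc := hX' K.starProjection (by rintro _ ⟨h, rfl⟩; exact hcomm h)
    have := congrArg (fun Y : Fock →L[ℂ] Fock => Y vacuum) hc
    change K.starProjection (X vacuum) = X (K.starProjection vacuum) at this
    rw [Submodule.starProjection_eq_self_iff.2 hvac] at this
    rw [← this]
    exact K.starProjection_apply_mem _
  have hle : L2SCsub ≤ K := by
    refine Submodule.topologicalClosure_minimal _ ?_ K₀.isClosed_topologicalClosure
    rintro _ ⟨X, hX, rfl⟩
    exact hSC X hX
  refine Subtype.dense_iff.2 fun x hx => ?_
  have h : x ∈ closure (K₀ : Set Fock) := hle hx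
  refine closure_mono ?_ h
  rintro _ ⟨X, hX, rfl⟩
  exact ⟨algToL2 ⟨X, hX⟩, ⟨_, rfl⟩, rfl⟩

/-! ### Contractions of a derivation and the abstract annihilation formula -/

section Contraction

variable {A V W : Type} [Ring A] [Algebra ℂ A] [AddCommGroup V] [Module ℂ V]
  [AddCommGroup W] [Module ℂ W]

/-- The linear map `k ⊗ (a ⊗ b) ↦ φ(k) θ(a) T(b)`. -/
def contract (φ : H →ₗ[ℂ] ℂ) (θ : A →ₗ[ℂ] ℂ) (T : A →ₗ[ℂ] V) : H ⊗[ℂ] (A ⊗[ℂ] A) →ₗ[ℂ] V :=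
  (TensorProduct.lid ℂ V).toLinearMap ∘ₗ
    TensorProduct.map φ ((TensorProduct.lid ℂ V).toLinearMap ∘ₗ TensorProduct.map θ T)

lemma contract_tmul (φ : H →ₗ[ℂ] ℂ) (θ : A →ₗ[ℂ] ℂ) (T : A →ₗ[ℂ] V) (k : H) (a b : A) :
    contract φ θ T (k ⊗ₜ (a ⊗ₜ b)) = φ k • θ a • T b := by
  simp only [contract, LinearMap.comp_apply, LinearEquiv.coe_coe, TensorProduct.map_tmul,
    TensorProduct.lid_tmul]

/-- The left action touches only the first leg, so the factor can be absorbed in `θ`. This is why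
inductions over words below let the functional on the first leg vary. -/
lemma contract_leftAct (φ : H →ₗ[ℂ] ℂ) (θ : A →ₗ[ℂ] ℂ) (T : A →ₗ[ℂ] V) (c : A)
    (z : H ⊗[ℂ] (A ⊗[ℂ] A)) :
    contract φ θ T (leftAct c z) = contract φ (θ ∘ₗ LinearMap.mulLeft ℂ c) T z := by
  have h : contract φ θ T ∘ₗ leftAct c = contract φ (θ ∘ₗ LinearMap.mulLeft ℂ c) T := by
    ext k a b; simp [leftAct_tmul, contract_tmul]
  exact congrArg (fun L : H ⊗[ℂ] (A ⊗[ℂ] A) →ₗ[ℂ] V => L z) h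

lemma contract_add_smul (φ : H →ₗ[ℂ] ℂ) (θ θ' : A →ₗ[ℂ] ℂ) (c : ℂ) (T : A →ₗ[ℂ] V) :
    contract φ (c • θ + θ') T = c • contract φ θ T + contract φ θ' T := by
  ext k a b
  simp [contract_tmul, add_smul, smul_smul, mul_left_comm]

lemma map_contract (L : V →ₗ[ℂ] W) (φ : H →ₗ[ℂ] ℂ) (θ : A →ₗ[ℂ] ℂ) (T : A →ₗ[ℂ] V)
    (z : H ⊗[ℂ] (A ⊗[ℂ] A)) : L (contract φ θ T z) = contract φ θ (L ∘ₗ T) z := by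
  have h : L ∘ₗ contract φ θ T = contract φ θ (L ∘ₗ T) := by
    ext k a b; simp [contract_tmul]
  exact congrArg (fun L : H ⊗[ℂ] (A ⊗[ℂ] A) →ₗ[ℂ] W => L z) h

/-- The derivation rule for products with a generator on the left. -/
lemma derivation_gen_mul {κ : Type} {g : κ → A} {d : κ → H} {D : A →ₗ[ℂ] H ⊗[ℂ] (A ⊗[ℂ] A)}
    (h1 : ∀ j, D (g j) = d j ⊗ₜ (1 ⊗ₜ 1))
    (h2 : ∀ a b, D (a * b) = leftAct a (D b) + rightAct b (D a)) (j : κ) (a : A) :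
    D (g j * a) = d j ⊗ₜ (1 ⊗ₜ a) + leftAct (g j) (D a) := by
  rw [h2, h1, rightAct_tmul, one_mul, add_comm]

lemma derivation_one {D : A →ₗ[ℂ] H ⊗[ℂ] (A ⊗[ℂ] A)}
    (h2 : ∀ a b, D (a * b) = leftAct a (D b) + rightAct b (D a)) : D 1 = 0 := by
  have h := h2 1 1
  rw [mul_one, leftAct_one, rightAct_one] at h
  simpa using h

variable {κ : Type} {g : κ → A} {d : κ → H} {D : A →ₗ[ℂ] H ⊗[ℂ] (A ⊗[ℂ] A)}

/-- The coassociativity `(D ⊗ id) ∘ D = (id ⊗ D) ∘ D`, tested against functionals. -/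
lemma contract_coassoc (h1 : D 1 = 0)
    (hD : ∀ j a, D (g j * a) = d j ⊗ₜ (1 ⊗ₜ a) + leftAct (g j) (D a))
    (φ₁ φ₂ : H →ₗ[ℂ] ℂ) (θ ψ : A →ₗ[ℂ] ℂ) (T : A →ₗ[ℂ] V) (w : List κ) :
    contract φ₂ (contract φ₁ θ ψ ∘ₗ D) T (D (w.map g).prod) =
      contract φ₁ θ (contract φ₂ ψ T ∘ₗ D) (D (w.map g).prod) := by
  -- Removing the first letter `g j` replaces `θ` by `θ(g j ·)`, so `θ` has to be free.
  induction w generalizing θ with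
  | nil => rw [List.map_nil, List.prod_nil, h1, map_zero, map_zero]
  | cons j w ih =>
    -- The inner derivative meets the letter `g j`, and Leibniz splits it into a term that
    -- differentiates the letter and a term that keeps it.
    have e : (contract φ₁ θ ψ ∘ₗ D) ∘ₗ LinearMap.mulLeft ℂ (g j) =
        (φ₁ (d j) * θ 1) • ψ + contract φ₁ (θ ∘ₗ LinearMap.mulLeft ℂ (g j)) ψ ∘ₗ D := by
      ext F
      simp only [LinearMap.comp_apply, LinearMap.mulLeft_apply, hD, map_add,
        contract_tmul, contract_leftAct, LinearMap.add_apply, LinearMap.smul_apply, smul_smul]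
    -- On the left, the term of `D (g j * w)` that differentiates `g j` has first leg `1` and
    -- disappears because `D 1 = 0`. On the right it gives the double contraction that `e` produces
    -- on the left from differentiating `g j` second.
    rw [List.map_cons, List.prod_cons, hD, map_add, map_add, contract_tmul, contract_tmul,
      contract_leftAct, contract_leftAct, e, contract_add_smul, LinearMap.add_apply, ih,
      LinearMap.smul_apply, LinearMap.comp_apply, LinearMap.comp_apply, h1, map_zero,
      zero_smul, smul_zero, zero_add, smul_smul]

variable (g) in
/-- The span of the `k ⊗ (a ⊗ b)` with `a`, `b` products of less than `n` generators. -/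
def shortSpan (n : ℕ) : Submodule ℂ (H ⊗[ℂ] (A ⊗[ℂ] A)) :=
  Submodule.span ℂ {z | ∃ (k : H) (a b : List κ), a.length < n ∧ b.length < n ∧
    z = k ⊗ₜ ((a.map g).prod ⊗ₜ (b.map g).prod)}

lemma leftAct_mem_shortSpan {n : ℕ} (j : κ) {z : H ⊗[ℂ] (A ⊗[ℂ] A)} (hz : z ∈ shortSpan g n) :
    leftAct (g j) z ∈ shortSpan g (n + 1) := by
  have h : shortSpan g n ≤ (shortSpan g (n + 1)).comap (leftAct (g j)) := by
    refine Submodule.span_le.2 ?_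
    rintro _ ⟨k, a, b, ha, hb, rfl⟩
    refine Submodule.subset_span ⟨k, j :: a, b, by simpa using ha, by omega, ?_⟩
    rw [leftAct_tmul, List.map_cons, List.prod_cons]
  exact h hz

/-- Differentiation deletes one letter and puts what precedes it and what follows it on the two
legs, so both legs are strictly shorter than the word. This is what allows strong induction on the
length inside `D`. -/
lemma derivation_mem_shortSpan (h1 : D 1 = 0)
    (hD : ∀ j a, D (g j * a) = d j ⊗ₜ (1 ⊗ₜ a) + leftAct (g j) (D a)) (w : List κ) :
    D (w.map g).prod ∈ shortSpan g w.length := by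
  induction w with
  | nil => rw [List.map_nil, List.prod_nil, h1]; exact zero_mem _
  | cons j w ih =>
    rw [List.map_cons, List.prod_cons, hD]
    -- The legs `1` and `w` have lengths `0` and `w.length`, both below `w.length + 1`.
    exact add_mem (Submodule.subset_span ⟨d j, [], w, by simp, by simp, by simp⟩)
      (leftAct_mem_shortSpan j ih)

/-- Allows an identity known only for short words, such as an induction hypothesis, to be
substituted inside a contraction. -/
lemma contract_congr {n : ℕ} (φ : H →ₗ[ℂ] ℂ) {θ θ' : A →ₗ[ℂ] ℂ} {T T' : A →ₗ[ℂ] V}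
    (hθ : ∀ a : List κ, a.length < n → θ (a.map g).prod = θ' (a.map g).prod)
    (hT : ∀ b : List κ, b.length < n → T (b.map g).prod = T' (b.map g).prod)
    {z : H ⊗[ℂ] (A ⊗[ℂ] A)} (hz : z ∈ shortSpan g n) : contract φ θ T z = contract φ θ' T' z := by
  have h : shortSpan g n ≤ LinearMap.eqLocus (contract φ θ T) (contract φ θ' T') := by
    refine Submodule.span_le.2 ?_
    rintro _ ⟨k, a, b, ha, hb, rfl⟩
    change contract φ θ T _ = contract φ θ' T' _
    rw [contract_tmul, contract_tmul, hθ a ha, hT b hb]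
  exact h hz

/-- If linear maps `N k` of `V` act on the vectors `T a` like annihilation operators, then they act
through the derivation `D`. -/
lemma annihilation_eq_contract (h1 : D 1 = 0)
    (hD : ∀ j a, D (g j * a) = d j ⊗ₜ (1 ⊗ₜ a) + leftAct (g j) (D a))
    (φ : H → H →ₗ[ℂ] ℂ) (T : A →ₗ[ℂ] V) (ε : V →ₗ[ℂ] ℂ) (N : H → V →ₗ[ℂ] V)
    (hε : ε (T 1) = 1) (hN : ∀ h, N h (T 1) = 0)
    (hT : ∀ h j a, N h (T (g j * a)) = φ h (d j) • T a + N h (N (d j) (T a)))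
    (hεT : ∀ j a, ε (T (g j * a)) = ε (N (d j) (T a))) (h : H) (w : List κ) :
    N h (T (w.map g).prod) = contract (φ h) (ε ∘ₗ T) T (D (w.map g).prod) := by
  -- The hypothesis is used for the tail at the vector `d j`, and for the shorter words on the legs
  -- of its derivative at both `d j` and `h`.
  induction hn : w.length using Nat.strong_induction_on generalizing h w with
  | _ n ih =>
  cases w with
  | nil => rw [List.map_nil, List.prod_nil, h1, map_zero, hN]
  | cons j w =>
    have hl : w.length + 1 = n := by simpa using hn
    have hw := derivation_mem_shortSpan h1 hD w
    -- With `τ = ε ∘ T`: `τ(g j * a) = ε(N (d j) (T a))`, and the induction hypothesis turns this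
    -- into `(φ (d j) ⊗ τ ⊗ τ)(D a)`.
    have e1 : ∀ a : List κ, a.length < w.length →
        ((ε ∘ₗ T) ∘ₗ LinearMap.mulLeft ℂ (g j)) (a.map g).prod =
          (contract (φ (d j)) (ε ∘ₗ T) (ε ∘ₗ T) ∘ₗ D) (a.map g).prod := fun a ha => by
      rw [LinearMap.comp_apply, LinearMap.mulLeft_apply, LinearMap.comp_apply, hεT,
        ih a.length (by omega) _ a rfl, map_contract, LinearMap.comp_apply]
    have e2 : ∀ b : List κ, b.length < w.length →
        (contract (φ h) (ε ∘ₗ T) T ∘ₗ D) (b.map g).prod = (N h ∘ₗ T) (b.map g).prod := fun b hb =>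
      (ih b.length (by omega) h b rfl).symm
    -- `e1` creates a second derivative on the first leg, coassociativity moves it to the second
    -- leg, and `e2` reads it there as `N h`. Pulling `N h` out leaves `N h (N (d j) (T w))`.
    rw [List.map_cons, List.prod_cons, hD, map_add, contract_tmul, contract_leftAct,
      contract_congr _ e1 (fun _ _ => rfl) hw, contract_coassoc h1 hD,
      contract_congr _ (fun _ _ => rfl) e2 hw, ← map_contract, hT,
      ih w.length (by omega) (d j) w rfl, LinearMap.comp_apply, hε, one_smul]

end Contraction

/-! ### Annihilation operators and the free Malliavin derivative -/

/-- The map `F ↦ F Ω` from `𝒮𝒞_alg` to the Fock space. -/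
def applyVacuum : SCalg →ₗ[ℂ] Fock := L2SCsub.subtype ∘ₗ algToL2

/-- The vacuum state on `𝒮𝒞_alg`. -/
def algTau : SCalg →ₗ[ℂ] ℂ := (innerSL ℂ vacuum).toLinearMap ∘ₗ applyVacuum

/-- The linear functional `k ↦ ⟨h, k⟩`. -/
def innerWith (h : H) : H →ₗ[ℂ] ℂ := (innerSL ℂ h).toLinearMap

lemma annihilation_vacuum (h : H) : annihilation h vacuum = 0 :=
  ((wordVec_deg []).annihilation h).eq_zero

lemma inner_vacuum_creation (h : H) (x : Fock) : inner ℂ vacuum (creation h x) = 0 := by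
  rw [← ContinuousLinearMap.adjoint_inner_left, annihilation_vacuum, inner_zero_left]

lemma inner_vacuum_vacuum : inner ℂ vacuum vacuum = (1 : ℂ) := by
  rw [vacuum, inner_level, level_apply_self, oneL2, L2.inner_def]
  have : (fun a => inner ℂ (oneL2 a) (oneL2 a)) =ᵐ[orthant 0] fun _ => (1 : ℂ) := by
    have h := MemLp.coeFn_toLp (memLp_const (1 : ℂ) : MemLp (fun _ => (1 : ℂ)) 2 (orthant 0))
    filter_upwards [h] with t ht
    rw [oneL2, ht]; simp
  exact (integral_congr_ae this).trans (by simp [measureReal_def])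

/-- The annihilation operators act on `F Ω` through the free Malliavin derivative of `F`. -/
lemma annihilation_applyVacuum (h : H) (F : SCalg) : annihilation h (applyVacuum F) =
    contract (innerWith h) algTau applyVacuum (freeMalliavin F) := by
  have hF := isFreeMalliavin_freeMalliavin
  have key := annihilation_eq_contract (g := fun j => Salg (realBasis j))
    (d := fun j => ofReal (realBasis j)) (derivation_one hF.leibniz)
    (derivation_gen_mul (fun j => hF.map_S _) hF.leibniz) innerWith applyVacuum
    (innerSL ℂ vacuum).toLinearMap (fun k => (annihilation k).toLinearMap) inner_vacuum_vacuum
    annihilation_vacuum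
    -- `l*(k) S(b) = ⟨k, b⟩ + l*(k) l*(b)`.
    (fun k j a => by
      change annihilation k (creation (ofReal (realBasis j)) (applyVacuum a) +
        annihilation (ofReal (realBasis j)) (applyVacuum a)) = _
      rw [map_add, annihilation_creation]
      rfl)
    -- The creation part of `S(b)` has range orthogonal to `Ω`.
    (fun j a => by
      change inner ℂ vacuum (creation (ofReal (realBasis j)) (applyVacuum a) +
        annihilation (ofReal (realBasis j)) (applyVacuum a)) = _
      rw [inner_add_right, inner_vacuum_creation, zero_add]
      rfl)
  have e : (annihilation h).toLinearMap ∘ₗ applyVacuum =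
      contract (innerWith h) algTau applyVacuum ∘ₗ freeMalliavin :=
    wordBasis.ext fun w => by
      have ew : wordBasis w = (w.map fun j => Salg (realBasis j)).prod := wordBasis_apply w
      rw [ew]
      exact key h w
  exact congrArg (fun L : SCalg →ₗ[ℂ] Fock => L F) e

/-! ### Averaging all legs but the last -/

section Collapse

variable {A V : Type} [Ring A] [Algebra ℂ A] [AddCommGroup V] [Module ℂ V]

/-- The functional `τ^{⊗ n}` on the algebraic tensor power. -/
def functionalPow (τ : A →ₗ[ℂ] ℂ) (n : ℕ) : ⨂[ℂ]^n A →ₗ[ℂ] ℂ :=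
  PiTensorProduct.lift ((MultilinearMap.mkPiAlgebra ℂ (Fin n) ℂ).compLinearMap fun _ => τ)

lemma functionalPow_tprod (τ : A →ₗ[ℂ] ℂ) {n : ℕ} (x : Fin n → A) :
    functionalPow τ n (PiTensorProduct.tprod ℂ x) = ∏ i, τ (x i) := by
  simp [functionalPow]

lemma functionalPow_snocTensor (τ : A →ₗ[ℂ] ℂ) {n : ℕ} (x : ⨂[ℂ]^n A) (y : A) :
    functionalPow τ (n + 1) (snocTensor A n (x ⊗ₜ y)) = functionalPow τ n x * τ y := by
  induction x using PiTensorProduct.induction_on with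
  | smul_tprod r x =>
    rw [← TensorProduct.smul_tmul', map_smul, map_smul, map_smul, snocTensor_tprod,
      functionalPow_tprod, functionalPow_tprod, Fin.prod_univ_castSucc]
    simp [mul_assoc]
  | add a b ha hb => rw [TensorProduct.add_tmul, map_add, map_add, map_add, ha, hb, add_mul]

/-- The linear map `f ⊗ (x₁ ⊗ … ⊗ xₙ) ⊗ y ↦ ψ(f) τ(x₁) ⋯ τ(xₙ) T(y)`. -/
def collapse {n : ℕ} (ψ : L2 n →ₗ[ℂ] ℂ) (τ : A →ₗ[ℂ] ℂ) (T : A →ₗ[ℂ] V) :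
    Multiprocess A n →ₗ[ℂ] V :=
  (TensorProduct.lid ℂ V).toLinearMap ∘ₗ TensorProduct.map
    ((TensorProduct.lid ℂ ℂ).toLinearMap ∘ₗ TensorProduct.map ψ (functionalPow τ n)) T

lemma collapse_tmul {n : ℕ} (ψ : L2 n →ₗ[ℂ] ℂ) (τ : A →ₗ[ℂ] ℂ) (T : A →ₗ[ℂ] V) (f : L2 n)
    (x : ⨂[ℂ]^n A) (y : A) :
    collapse ψ τ T ((f ⊗ₜ x) ⊗ₜ y) = (ψ f * functionalPow τ n x) • T y := by
  simp only [collapse, LinearMap.comp_apply, LinearEquiv.coe_coe, TensorProduct.map_tmul,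
    TensorProduct.lid_tmul, smul_eq_mul]

/-- Induction over multiprocesses. -/
lemma Multiprocess.induction {n : ℕ} {P : Multiprocess A n → Prop}
    (tmul : ∀ f x y, P ((f ⊗ₜ PiTensorProduct.tprod ℂ x) ⊗ₜ y)) (zero : P 0)
    (add : ∀ z z', P z → P z' → P (z + z')) (z : Multiprocess A n) : P z := by
  induction z using TensorProduct.induction_on with
  | zero => exact zero
  | add z z' h h' => exact add z z' h h'
  | tmul w y =>
    induction w using TensorProduct.induction_on with
    | zero => rw [TensorProduct.zero_tmul]; exact zero
    | add w w' h h' => rw [TensorProduct.add_tmul]; exact add _ _ h h'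
    | tmul f x =>
      induction x using PiTensorProduct.induction_on with
      | smul_tprod r x =>
        rw [← TensorProduct.smul_tmul]
        exact tmul _ _ _
      | add a b ha hb =>
        rw [TensorProduct.tmul_add, TensorProduct.add_tmul]
        exact add _ _ ha hb

/-- Differentiating the last leg creates one time variable and one more leg to average. As `ψ'`
splits into `φ` and `ψ`, these new slots are contracted exactly as in `contract φ τ T`, which `hN`
identifies with `N`. -/
lemma collapse_derivLastLeg (D : A →ₗ[ℂ] H ⊗[ℂ] (A ⊗[ℂ] A)) {n : ℕ} {ψ : L2 n →ₗ[ℂ] ℂ}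
    {ψ' : L2 (n + 1) →ₗ[ℂ] ℂ} {φ : H →ₗ[ℂ] ℂ} {τ : A →ₗ[ℂ] ℂ} {T : A →ₗ[ℂ] V} {N : V →ₗ[ℂ] V}
    (hψ : ∀ h f, ψ' (insertVar (Fin.last n) h f) = φ h * ψ f)
    (hN : ∀ y, N (T y) = contract φ τ T (D y)) (z : Multiprocess A n) :
    collapse ψ' τ T (derivLastLeg D n z) = N (collapse ψ τ T z) := by
  induction z using Multiprocess.induction with
  | zero => simp only [map_zero]
  | add z z' h h' => simp only [map_add, h, h']
  | tmul f x y =>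
    rw [collapse_tmul, map_smul, hN]
    simp only [derivLastLeg, LinearMap.comp_apply, LinearMap.lTensor_tmul, LinearEquiv.coe_coe]
    -- Both sides are now linear in `D y`, so an arbitrary tensor may replace it and then be taken
    -- elementary.
    generalize D y = ζ
    induction ζ using TensorProduct.induction_on with
    | zero => simp only [map_zero, TensorProduct.tmul_zero, smul_zero]
    | add ζ ζ' h h' => simp only [map_add, TensorProduct.tmul_add, smul_add, h, h']
    | tmul k c =>
      induction c using TensorProduct.induction_on with
      | zero => simp only [map_zero, TensorProduct.tmul_zero, smul_zero]
      | add c c' h h' => simp only [map_add, TensorProduct.tmul_add, smul_add, h, h']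
      | tmul a b =>
        simp only [TensorProduct.assoc_symm_tmul, LinearMap.rTensor_tmul, LinearMap.comp_apply,
          LinearEquiv.coe_coe, TensorProduct.tensorTensorTensorComm_tmul, TensorProduct.map_tmul,
          TensorProduct.lift.tmul, LinearMap.flip_apply, collapse_tmul, hψ,
          functionalPow_snocTensor, contract_tmul, smul_smul]
        congr 1
        ring

end Collapse

/-! ### Rectangles and iterated annihilation -/

/-- Counterpart of `boxIndicator_succ` at the other end: `derivLastLeg` inserts its variable last,
whereas left creation inserts it first. -/
lemma boxIndicator_snoc {n : ℕ} (u v : Fin (n + 1) → ℝ) :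
    insertVar (Fin.last n) (intervalIndicator (u (Fin.last n)) (v (Fin.last n)))
      (boxIndicator (Fin.init u) (Fin.init v)) = boxIndicator u v := by
  refine Lp.ext ?_
  have h1 := insertVar_coeFn (Fin.last n) (intervalIndicator (u (Fin.last n)) (v (Fin.last n)))
    (boxIndicator (Fin.init u) (Fin.init v))
  have h2 := (eval_qmp (Fin.last n)).ae (indicatorConstLp_coeFn (p := 2)
    (hs := measurableSet_Icc) (hμs := halfLine_Icc_ne_top (u (Fin.last n)) (v (Fin.last n)))
    (c := (1 : ℂ)))
  have h3 := (removeNth_qmp (Fin.last n)).ae (indicatorConstLp_coeFn (p := 2)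
    (hs := measurableSet_box (Fin.init u) (Fin.init v)) (hμs := box_ne_top _ _) (c := (1 : ℂ)))
  have h4 := indicatorConstLp_coeFn (p := 2)
    (hs := measurableSet_box u v) (hμs := box_ne_top _ _) (c := (1 : ℂ))
  filter_upwards [h1, h2, h3, h4] with t h1 h2 h3 h4
  rw [h1]
  refine Eq.trans ?_ h4.symm
  refine (congrArg₂ (· * ·) h2 h3).trans ?_
  have hiff : t ∈ box u v ↔ t (Fin.last n) ∈ Set.Icc (u (Fin.last n)) (v (Fin.last n)) ∧
      ((Fin.last n).removeNth t) ∈ box (Fin.init u) (Fin.init v) := by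
    simp only [box, Set.mem_univ_pi]
    rw [Fin.forall_fin_succ', Fin.removeNth_last, and_comm]
    rfl
  by_cases hc : t ∈ box u v
  · obtain ⟨ha, hb⟩ := hiff.1 hc
    rw [Set.indicator_of_mem hc, Set.indicator_of_mem ha, Set.indicator_of_mem hb, mul_one]
  · rw [Set.indicator_of_notMem hc]
    by_cases ha : t (Fin.last n) ∈ Set.Icc (u (Fin.last n)) (v (Fin.last n))
    · rw [Set.indicator_of_notMem fun hb => hc (hiff.2 ⟨ha, hb⟩), mul_zero]
    · rw [Set.indicator_of_notMem ha, zero_mul]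

/-- The product of the creation operators of the sides of a rectangle. -/
def boxCreation {n : ℕ} (u v : Fin n → ℝ) : Fock →L[ℂ] Fock :=
  (List.ofFn fun i => creation (intervalIndicator (u i) (v i))).prod

lemma boxCreation_vacuum {n : ℕ} (u v : Fin n → ℝ) :
    boxCreation u v vacuum = level n (boxIndicator u v) := by
  induction n with
  | zero =>
    rw [boxIndicator_zero, boxCreation, List.ofFn_zero, List.prod_nil]
    rfl
  | succ n ih =>
    rw [← boxIndicator_succ, ← creation_level, ← ih, boxCreation, List.ofFn_succ, List.prod_cons]
    rfl

/-- The creation operator of the last side acts first in the product, so its adjoint acts last, just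
as `∇` in the last variable is the last derivative taken. -/
lemma adjoint_boxCreation_snoc {n : ℕ} (u v : Fin (n + 1) → ℝ) (x : Fock) :
    ContinuousLinearMap.adjoint (boxCreation u v) x =
      annihilation (intervalIndicator (u (Fin.last n)) (v (Fin.last n)))
        (ContinuousLinearMap.adjoint (boxCreation (Fin.init u) (Fin.init v)) x) := by
  have e : boxCreation u v = boxCreation (Fin.init u) (Fin.init v) ∘L
      creation (intervalIndicator (u (Fin.last n)) (v (Fin.last n))) := by
    rw [boxCreation, List.ofFn_succ_last, List.prod_append, List.prod_singleton]
    rfl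
  rw [e, ContinuousLinearMap.adjoint_comp]
  rfl

/-- The linear functional `g ↦ ⟨f, g⟩` on `L²(ℝ₊ⁿ)`. -/
def innerWithL2 {n : ℕ} (f : L2 n) : L2 n →ₗ[ℂ] ℂ := (innerSL ℂ f).toLinearMap

lemma innerWithL2_boxIndicator_zero (u v : Fin 0 → ℝ) :
    innerWithL2 (boxIndicator u v) oneL2 = 1 := by
  have h := inner_vacuum_vacuum
  rw [vacuum, inner_level, level_apply_self] at h
  rw [boxIndicator_zero]
  exact h

/-- The contraction of `Dⁿ y` with the indicator function of a rectangle. -/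
lemma collapse_iteratedDerivation {A : Type} [Ring A] [Algebra ℂ A]
    (D : A →ₗ[ℂ] H ⊗[ℂ] (A ⊗[ℂ] A)) (τ : A →ₗ[ℂ] ℂ) (T : A →ₗ[ℂ] Fock)
    (hT : ∀ h y, annihilation h (T y) = contract (innerWith h) τ T (D y))
    {n : ℕ} (u v : Fin n → ℝ) (y : A) :
    collapse (innerWithL2 (boxIndicator u v)) τ T (iteratedDerivation D n y) =
      ContinuousLinearMap.adjoint (boxCreation u v) (T y) := by
  induction n with
  | zero =>
    have e : iteratedDerivation D 0 y =
      (oneL2 ⊗ₜ PiTensorProduct.tprod ℂ (Fin.elim0 : Fin 0 → A)) ⊗ₜ y := rfl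
    have e' : boxCreation u v = ContinuousLinearMap.id ℂ Fock := by
      rw [boxCreation, List.ofFn_zero, List.prod_nil]; rfl
    rw [e, collapse_tmul, innerWithL2_boxIndicator_zero, functionalPow_tprod, Fin.prod_univ_zero,
      mul_one, one_smul, e', ContinuousLinearMap.adjoint_id]
    rfl
  | succ n ih =>
    rw [adjoint_boxCreation_snoc, ← ih]
    exact collapse_derivLastLeg D
      (N := (annihilation (intervalIndicator (u (Fin.last n)) (v (Fin.last n)))).toLinearMap)
      -- The indicator of a rectangle is a tensor product, so pairing with it splits off the last
      -- variable.
      (fun h f => by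
        rw [← boxIndicator_snoc]
        exact inner_insertVar _ _ _ _ _)
      (hT _) _

lemma collapse_iteratedMalliavin {n : ℕ} (u v : Fin n → ℝ) (F : SCalg) :
    collapse (innerWithL2 (boxIndicator u v)) algTau applyVacuum (iteratedMalliavin n F) =
      ContinuousLinearMap.adjoint (boxCreation u v) (applyVacuum F) :=
  collapse_iteratedDerivation freeMalliavin algTau applyVacuum annihilation_applyVacuum u v F

/-! ### Duality with the Wigner integral -/

lemma inner_scalarTimes {p : ℕ} (f g : L2 p) (v w : L2SCpow (p + 1)) :
    inner ℂ (scalarTimes p f v) (scalarTimes p g w) = inner ℂ f g * inner ℂ v w := by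
  rw [L2.inner_def, L2.inner_def, ← integral_mul_const]
  refine integral_congr_ae ?_
  filter_upwards [scalarTimes_coeFn p f v, scalarTimes_coeFn p g w] with t h1 h2
  rw [h1, h2, inner_smul_left, inner_smul_right, RCLike.inner_apply]
  ring

/-- Pairing a leg with `1` is evaluating it in the vacuum state. The first `p` legs are averaged
inside `collapse`, the last one by the outer product with `Ω`. -/
lemma inner_deterministic_multiprocessToM2 {A : Type} [Ring A] [Algebra ℂ A] (j : A →ₗ[ℂ] L2SC)
    {p : ℕ} (f : L2 p) (z : Multiprocess A p) :
    inner ℂ (deterministic p f) (multiprocessToM2 j p z) =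
      inner ℂ vacuum (collapse (innerWithL2 f)
        ((innerSL ℂ vacuum).toLinearMap ∘ₗ L2SCsub.subtype ∘ₗ j) (L2SCsub.subtype ∘ₗ j) z) := by
  have hin : ∀ a, inner ℂ (algToL2 1) (j a) =
      ((innerSL ℂ vacuum).toLinearMap ∘ₗ L2SCsub.subtype ∘ₗ j) a := fun _ => rfl
  induction z using Multiprocess.induction with
  | zero => simp only [map_zero, inner_zero_right]
  | add z z' h h' => simp only [map_add, inner_add_right, h, h']
  | tmul g x y =>
    have e : multiprocessToM2 j p ((g ⊗ₜ PiTensorProduct.tprod ℂ x) ⊗ₜ y) =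
        scalarTimes p g (ofTensor L2SC (p + 1) (PiTensorProduct.map (fun _ => j)
          (snocTensor A p (PiTensorProduct.tprod ℂ x ⊗ₜ y)))) := rfl
    rw [e, deterministic, inner_scalarTimes, snocTensor_tprod, PiTensorProduct.map_tprod, onePow,
      inner_ofTensor_tprod, collapse_tmul, inner_smul_right, functionalPow_tprod,
      Fin.prod_univ_castSucc, mul_assoc]
    simp only [Fin.snoc_castSucc, Fin.snoc_last, hin]
    rfl

lemma inner_deterministic {p : ℕ} (f : L2 p) (z : Multiprocess SCalg p) :
    inner ℂ (deterministic p f) (multiprocessToM2 algToL2 p z) =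
      inner ℂ vacuum (collapse (innerWithL2 f) algTau applyVacuum z) :=
  inner_deterministic_multiprocessToM2 algToL2 f z

/-- The map `f ↦ f · 1^{⊗ (p + 1)}` as a continuous linear map. -/
def deterministicL (p : ℕ) : L2 p →L[ℂ] M2 p :=
  (ContinuousLinearMap.toSpanSingleton ℂ (onePow (p + 1))).compLpL 2 (orthant p)

/-- Both sides are `⟨Ω, l*(e_p) ⋯ l*(e₁) FΩ⟩`, with `eᵢ` the sides of the rectangle. The rectangle
may meet the diagonals here. -/
lemma inner_deterministic_boxIndicator {p : ℕ} (u v : Fin p → ℝ) (F : SCalg) :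
    inner ℂ (deterministic p (boxIndicator u v))
        (multiprocessToM2 algToL2 p (iteratedMalliavin p F)) =
      inner ℂ (level p (boxIndicator u v)) (applyVacuum F) := by
  rw [inner_deterministic, collapse_iteratedMalliavin, ContinuousLinearMap.adjoint_inner_right,
    boxCreation_vacuum]

/-- An identity between continuous linear maps on `L²(ℝ₊ⁿ)` may be tested on rectangles off the
diagonals. -/
lemma inner_eq_of_boxIndicator {E E' : Type} [NormedAddCommGroup E] [InnerProductSpace ℂ E]
    [CompleteSpace E] [NormedAddCommGroup E'] [InnerProductSpace ℂ E'] [CompleteSpace E'] {n : ℕ}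
    (I : L2 n →L[ℂ] E) (J : L2 n →L[ℂ] E') (x : E) (y : E')
    (h : ∀ u v : Fin n → ℝ, (∀ i, 0 ≤ u i ∧ u i ≤ v i) → Disjoint (box u v) (diagonals n) →
      inner ℂ (I (boxIndicator u v)) x = inner ℂ (J (boxIndicator u v)) y) (f : L2 n) :
    inner ℂ (I f) x = inner ℂ (J f) y := by
  -- The vector `I* x - J* y` of `L²(ℝ₊ⁿ)` is orthogonal to a total family.
  have hz := eq_zero_of_inner_boxIndicator
    (ContinuousLinearMap.adjoint I x - ContinuousLinearMap.adjoint J y) fun u v huv hd => by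
    rw [inner_sub_right, ContinuousLinearMap.adjoint_inner_right,
      ContinuousLinearMap.adjoint_inner_right, h u v huv hd, sub_self]
  rw [← ContinuousLinearMap.adjoint_inner_right, sub_eq_zero.1 hz,
    ContinuousLinearMap.adjoint_inner_right]

/-- Here the diagonals must be avoided: the sides are then pairwise orthogonal, the annihilation
part of each increment kills the tensor to its right, and the product sends `Ω` to the indicator
itself. -/
lemma inner_brownianProduct {n : ℕ} (u v : Fin n → ℝ) (huv : ∀ i, 0 ≤ u i ∧ u i ≤ v i)
    (hd : Disjoint (box u v) (diagonals n)) (F : SCalg) :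
    inner ℂ (algToL2 (brownianProduct u v)) (algToL2 F) =
      inner ℂ (level n (boxIndicator u v)) (applyVacuum F) := by
  rw [← brownianProduct_vacuum u v huv fun i j hij => disjoint_of_offDiagonal huv hd hij]
  rfl

/-- The duality between the multiple Wigner integral and the iterated free Malliavin derivative. -/
lemma inner_wignerIntegral_algToL2 (p : ℕ) (f : L2 p) (F : SCalg) :
    inner ℂ (wignerIntegral p f) (algToL2 F) =
      inner ℂ (deterministic p f) (multiprocessToM2 algToL2 p (iteratedMalliavin p F)) :=
  inner_eq_of_boxIndicator (wignerIntegral p) (deterministicL p) _ _ (fun u v huv hd =>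
    (congrArg (fun x => inner ℂ x (algToL2 F))
      (isWignerIntegral_wignerIntegral p u v huv hd)).trans
      ((inner_brownianProduct u v huv hd F).trans
        (inner_deterministic_boxIndicator u v F).symm)) f

lemma dense_domain_nabla (p : ℕ) : Dense ((nabla p).domain : Set L2SC) := by
  have h : ((nabla p).domain : Set L2SC) = Set.range algToL2 := LinearMap.coe_range algToL2
  rw [h]
  exact denseRange_algToL2

lemma inner_wignerIntegral_nabla (p : ℕ) (f : L2 p) (x : (nabla p).domain) :
    inner ℂ (wignerIntegral p f) (x : L2SC) = inner ℂ (deterministic p f) (nabla p x) := by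
  obtain ⟨_, F, rfl⟩ := x
  rw [nabla_apply]
  exact inner_wignerIntegral_algToL2 p f F

end FreeWigner

end

theorem mainTheorem8 (p : ℕ) (hp : 1 ≤ p) (f : FreeWigner.L2 p) :
    ∃ h : FreeWigner.deterministic p f ∈ (FreeWigner.freeSkorohod p).domain,
      FreeWigner.freeSkorohod p ⟨FreeWigner.deterministic p f, h⟩ =
        FreeWigner.wignerIntegral p f := by
  have hf := FreeWigner.inner_wignerIntegral_nabla p f
  -- The duality exhibits `I_p(f)` as a vector representing `F ↦ ⟨f · 1 ⊗ ⋯ ⊗ 1, ∇ᵖF⟩`, which gives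
  -- membership in the domain. Density makes that vector unique, hence equal to the value of the
  -- adjoint.
  exact ⟨LinearPMap.mem_adjoint_domain_of_exists _ ⟨_, hf⟩,
    LinearPMap.adjoint_apply_eq (FreeWigner.dense_domain_nabla p) _ hf⟩
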